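/- Fix an abelian group $\Lambda$. A graded superring is a $\Lambda\times\mathbb Z_2$-graded (associative unital) ring; modules are $\Lambda\times\mathbb Z_2$-graded modules, $A\text{-mod}$ is the category of left $A$-modules with $A$-linear maps of degree $(0,0)$ as morphisms, ring homomorphisms and automorphisms have degree $0$, and $\bar v$ denotes the $\mathbb Z_2$-degree of a homogeneous element $v$ (formulas involving $\bar v$ are for homogeneous elements and are extended additively). The module $\{\lambda,\pi\}M$ is $M$ with the grading $(\{\lambda,\pi\}M)_{\lambda',\pi'}=M_{\lambda'-\lambda,\pi'-\pi}$ and the action $a\cdot m=(-1)^{\pi\bar a}am$. $\mathrm{HOM}_B(M,N)$ is the direct sum over $(\lambda,\pi)$ of the groups of additive maps $f\colon M\to N$ that are homogeneous of degree $(\lambda,\pi)$ and satisfy $f(bm)=(-1)^{\pi\bar b}bf(m)$. For a graded subring $B\subseteq A$ and automorphisms $\alpha$ of $A$ and $\beta$ of $B$, $A$ is an $(\alpha,\beta)$-Frobenius extension of $B$ of degree $(-\lambda,\pi)$ if $A$ is finitely generated and projective as a left $B$-module and there is a trace map, i.e. an additive map $\mathrm{tr}\colon A\to B$, homogeneous of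 degree $(-\lambda,\pi)$, with $\mathrm{tr}(\beta(b)a)=(-1)^{\pi\bar b}b\,\mathrm{tr}(a)$ and $\mathrm{tr}(a\alpha(b))=\mathrm{tr}(a)b$ for $a\in A$, $b\in B$, such that (T1) $\mathrm{tr}(Aa)=0$ implies $a=0$, and (T2) every $\varphi\in\mathrm{HOM}_B({}^\beta_BA,\{\lambda,\pi\}B)$ has the form $\varphi(c)=\mathrm{tr}\big((-1)^{\bar a\bar c}ca\big)$ for some $a\in A$; here ${}^\beta_BA$ is $A$ with the left action $b\cdot a=\beta(b)a$. It is untwisted if $\alpha$ and $\beta$ are identities. **Theorem.** Let $R\subseteq B\subseteq A$ be graded superrings with $C_A(R)=A$, i.e. $ar=(-1)^{\bar a\bar r}ra$ for all $a\in A$, $r\in R$. Suppose that $A$ and $B$ are untwisted Frobenius extensions of $R$ of degrees $(-\lambda_A,\pi_A)$ and $(-\lambda_B,\pi_B)$, with trace maps $\mathrm{tr}_A$ and $\mathrm{tr}_B$, and that $A$ is projective as a left $B$-module. Then: 1. There are unique automorphisms $\psi_A$ of $A$ and $\psi_B$ of $B$ (the Nakayama automorphisms) with $\mathrm{tr}_A(ca)=(-1)^{\bar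 a\bar c}\,\mathrm{tr}_A(a\psi_A(c))$ for all $a,c\in A$ and $\mathrm{tr}_B(ca)=(-1)^{\bar a\bar c}\,\mathrm{tr}_B(a\psi_B(c))$ for all $a,c\in B$. There are also dual sets of generators of $B$ over $R$: homogeneous elements $x_1,\dots,x_n$, $y_1,\dots,y_n$ of $B$ with $\deg x_i+\deg y_i=(\lambda_B,\pi_B)$ and, for all $b\in B$, $$b=(-1)^{\pi_B\bar b}\sum_{i=1}^n(-1)^{\pi_B\bar x_i}\,\mathrm{tr}_B(by_i)x_i=\sum_{i=1}^n y_i\,\mathrm{tr}_B(x_ib).$$ 2. $A$ is a $(\psi_A,\psi_B)$-Frobenius extension of $B$ of degree $(\lambda_B-\lambda_A,\pi_A+\pi_B)$. For any dual sets of generators $\{x_i\}$, $\{y_i\}$ of $B$ over $R$, a trace map for it is given by $$\mathrm{tr}(a)=(-1)^{\pi_B(\pi_A+\bar a)}\sum_{i=1}^n(-1)^{\bar y_i(\pi_B+\bar a)}\,\mathrm{tr}_A(y_ia)\,x_i .$$ 3. The induction functor ${}_AA_B\otimes_B-\colon B\text{-mod}\to A\text{-mod}$ is right adjoint to the shifted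 twisted restriction functor $\{\lambda_B-\lambda_A,\pi_A+\pi_B\}\,{}^{\psi_B}_BA^{\psi_A}_A\otimes_A-\colon A\text{-mod}\to B\text{-mod}$, where ${}^{\psi_B}_BA^{\psi_A}_A$ is $A$ with the left action $b\cdot a=\psi_B(b)a$ of $B$ and the right action $a\cdot a'=a\psi_A(a')$ of $A$. -/

import Mathlib

open DirectSum TensorProduct CategoryTheory

universe t u u₁ u₂ v w

set_option linter.unusedSectionVars false

noncomputable section

namespace NestedFrobenius

variable {Λ : Type t} [AddCommGroup Λ] [DecidableEq Λ]

/-! ### Signs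

A graded superring is a ring `A` with `GradedRing 𝒜`, where `𝒜 : Λ × ZMod 2 → AddSubgroup A`. -/

section Signs

variable {M : Type*} [AddCommGroup M] (ℳ : Λ × ZMod 2 → AddSubgroup M) [Decomposition ℳ]

/-- The additive map with `m ↦ (-1) ^ (p * m̄) m` for homogeneous `m`. -/
def signTwist (p : ZMod 2) : M →+ M :=
  (DirectSum.toAddMonoid fun i : Λ × ZMod 2 =>
    ((-1 : ℤˣ) ^ (p * i.2)) • (ℳ i).subtype).comp (decomposeAddEquiv ℳ).toAddMonoidHom

theorem signTwist_of_mem (p : ZMod 2) {i : Λ × ZMod 2} {m : M} (hm : m ∈ ℳ i) :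
    signTwist ℳ p m = ((-1 : ℤˣ) ^ (p * i.2)) • m := by
  simp [signTwist, decompose_of_mem ℳ hm]

theorem of_congr {ι M : Type*} [DecidableEq ι] [AddCommGroup M] (ℳ : ι → AddSubgroup M)
    {i k : ι} (h : i = k) (x : ℳ i) (y : ℳ k) (hxy : (x : M) = y) :
    DirectSum.of (fun i => ℳ i) i x = DirectSum.of (fun i => ℳ i) k y := by
  subst h
  rw [Subtype.ext hxy]

end Signs

section Rings

variable {A : Type*} [Ring A] (𝒜 : Λ × ZMod 2 → AddSubgroup A) [GradedRing 𝒜]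

/-- `signTwist` on a graded superring is a ring homomorphism. -/
def signHom (p : ZMod 2) : A →+* A :=
  { signTwist 𝒜 p with
    map_one' := by
      have h : (1 : A) ∈ 𝒜 0 := SetLike.GradedOne.one_mem
      change signTwist 𝒜 p 1 = 1
      rw [signTwist_of_mem 𝒜 p h]
      simp
    map_mul' := by
      intro x y
      change signTwist 𝒜 p (x * y) = signTwist 𝒜 p x * signTwist 𝒜 p y
      induction x using Decomposition.inductionOn 𝒜 with
      | zero => simp
      | add a b ha hb => rw [add_mul, map_add, ha, hb, map_add, add_mul]
      | @homogeneous i a =>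
        induction y using Decomposition.inductionOn 𝒜 with
        | zero => simp
        | add b c hb hc => rw [mul_add, map_add, hb, hc, map_add, mul_add]
        | @homogeneous k b =>
          rw [signTwist_of_mem 𝒜 p a.2, signTwist_of_mem 𝒜 p b.2,
            signTwist_of_mem 𝒜 p (SetLike.mul_mem_graded a.2 b.2), Prod.snd_add, mul_add,
            uzpow_add, smul_mul_smul_comm] }

theorem signHom_of_mem (p : ZMod 2) {i : Λ × ZMod 2} {a : A} (ha : a ∈ 𝒜 i) :
    signHom 𝒜 p a = ((-1 : ℤˣ) ^ (p * i.2)) • a :=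
  signTwist_of_mem 𝒜 p ha

/-- The signed right multiplication operator: for homogeneous `a` and `m`, it is
`ʳa (m) = (-1) ^ (ā * m̄) m a`; it is additive in `a` and in `m`. -/
def rightOp : A →+ A →+ A :=
  (DirectSum.toAddMonoid fun i : Λ × ZMod 2 =>
    ((AddMonoidHom.compHom.flip (signTwist 𝒜 i.2)).comp
      (AddMonoidHom.mul (R := A)).flip).comp (𝒜 i).subtype).comp
    (decomposeAddEquiv 𝒜).toAddMonoidHom

theorem rightOp_of_mem {i k : Λ × ZMod 2} {a m : A} (ha : a ∈ 𝒜 i) (hm : m ∈ 𝒜 k) :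
    rightOp 𝒜 a m = ((-1 : ℤˣ) ^ (i.2 * k.2)) • (m * a) := by
  simp [rightOp, decompose_of_mem 𝒜 ha, signTwist_of_mem 𝒜 _ hm, smul_mul_assoc]

variable {𝒜} {R : Type*} [Ring R] {ℛ : Λ × ZMod 2 → AddSubgroup R} [GradedRing ℛ]

/-- The centralizer `C_A(R)`, for `f : R → A`: all `a` whose homogeneous components `c` satisfy
`c r = (-1) ^ (c̄ * r̄) r c` for every homogeneous `r` in `R`. -/
def superCentralizer (f : ℛ →+*ᵍ 𝒜) : AddSubgroup A where
  carrier := {a | ∀ (i k : Λ × ZMod 2) (r : R), r ∈ ℛ k →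
    (decompose 𝒜 a i : A) * f r = ((-1 : ℤˣ) ^ (i.2 * k.2)) • (f r * (decompose 𝒜 a i : A))}
  zero_mem' := by intro i k r _; simp
  add_mem' := by
    intro a b ha hb i k r hr
    simp only [decompose_add, DirectSum.add_apply, AddMemClass.coe_add, add_mul, mul_add,
      smul_add, ha i k r hr, hb i k r hr]
  neg_mem' := by
    intro a ha i k r hr
    have h : (decompose 𝒜 (-a) i : A) = -(decompose 𝒜 a i : A) := by rw [decompose_neg]; rfl
    rw [h, neg_mul, mul_neg, smul_neg, ha i k r hr]

end Rings

/-! ### Graded supermodules -/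

/-- Left graded supermodules over the graded superring `B`. -/
structure GSMod {B : Type u} [Ring B] (ℬ : Λ × ZMod 2 → AddSubgroup B) where
  carrier : Type w
  [addCommGroup : AddCommGroup carrier]
  [module : Module B carrier]
  grading : Λ × ZMod 2 → AddSubgroup carrier
  [decomposition : Decomposition grading]
  smul_mem : ∀ {i k : Λ × ZMod 2} {b : B} {m : carrier},
    b ∈ ℬ i → m ∈ grading k → b • m ∈ grading (i + k)

attribute [instance] GSMod.addCommGroup GSMod.module GSMod.decomposition

namespace GSMod

variable {B : Type u} [Ring B] {ℬ : Λ × ZMod 2 → AddSubgroup B}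

/-- `HOM_B(M, N)_d`, the homomorphisms of degree `d`. -/
def homDeg (M N : GSMod ℬ) (d : Λ × ZMod 2) : AddSubgroup (M.carrier →+ N.carrier) where
  carrier := {f | (∀ (i : Λ × ZMod 2) (m : M.carrier), m ∈ M.grading i → f m ∈ N.grading (d + i)) ∧
    ∀ (i : Λ × ZMod 2) (b : B) (m : M.carrier), b ∈ ℬ i →
      f (b • m) = ((-1 : ℤˣ) ^ (d.2 * i.2)) • b • f m}
  zero_mem' := ⟨fun _ _ _ => zero_mem _, fun _ _ _ _ => by simp⟩
  add_mem' := by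
    rintro f g ⟨hf, hf'⟩ ⟨hg, hg'⟩
    refine ⟨fun i m hm => add_mem (hf i m hm) (hg i m hm), fun i b m hb => ?_⟩
    simp [hf' i b m hb, hg' i b m hb]
  neg_mem' := by
    rintro f ⟨hf, hf'⟩
    refine ⟨fun i m hm => neg_mem (hf i m hm), fun i b m hb => ?_⟩
    simp [hf' i b m hb]

/-- `HOM_B(M, N)`, the (automatically direct) sum of the groups `HOM_B(M, N)_d`. -/
def HOM (M N : GSMod ℬ) : AddSubgroup (M.carrier →+ N.carrier) := ⨆ d, homDeg M N d

/-- Morphisms of graded supermodules: linear maps of degree zero. -/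
@[ext]
structure Hom (M N : GSMod ℬ) where
  toLinearMap : M.carrier →ₗ[B] N.carrier
  map_mem : ∀ (i : Λ × ZMod 2) (m : M.carrier), m ∈ M.grading i → toLinearMap m ∈ N.grading i

instance : Category (GSMod.{t, u, w} ℬ) where
  Hom M N := Hom M N
  id M := ⟨LinearMap.id, fun _ _ h => h⟩
  comp f g := ⟨g.toLinearMap.comp f.toLinearMap, fun i m h => g.map_mem i _ (f.map_mem i m h)⟩

/-- The graded supermodule `A`, on which `B` acts through `f : B → A` and left multiplication.
For an automorphism `β` of `B` and `j : B → A`, the choice `f = j ∘ β` gives `^β_B A`. -/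
def ofHom {A : Type w} [Ring A] {𝒜 : Λ × ZMod 2 → AddSubgroup A} [GradedRing 𝒜]
    (f : ℬ →+*ᵍ 𝒜) : GSMod ℬ where
  carrier := A
  module := Module.compHom A f.toRingHom
  grading := 𝒜
  smul_mem hb hm := SetLike.mul_mem_graded (f.map_mem hb) hm

section Shift

/-- The decomposition of `M` for the shifted grading `k ↦ M_{k - d}`. -/
abbrev shiftDecomposition {M : Type*} [AddCommGroup M] (ℳ : Λ × ZMod 2 → AddSubgroup M)
    [Decomposition ℳ] (d : Λ × ZMod 2) : Decomposition fun k => ℳ (k - d) :=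
  Decomposition.ofAddHom _
    ((DirectSum.toAddMonoid fun i : Λ × ZMod 2 =>
      (DirectSum.of (fun k => ℳ (k - d)) (i + d)).comp
        (AddSubgroup.inclusion (le_of_eq (congrArg ℳ (add_sub_cancel_right i d).symm)))).comp
      (decomposeAddEquiv ℳ).toAddMonoidHom)
    (by
      ext m
      induction m using Decomposition.inductionOn ℳ with
      | zero => simp
      | add a b ha hb => rw [map_add, ha, hb, map_add]
      | homogeneous a => simp)
    (by
      ext k ⟨m, hm⟩ : 2
      have : decompose ℳ m = DirectSum.of (fun i => ℳ i) (k - d) ⟨m, hm⟩ := decompose_of_mem ℳ hm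
      simp only [AddMonoidHom.comp_apply, coeAddMonoidHom_of, AddEquiv.toAddMonoidHom_eq_coe,
        AddMonoidHom.coe_coe, decomposeAddEquiv_apply, this, toAddMonoid_of, AddMonoidHom.id_apply]
      exact of_congr (fun k => ℳ (k - d)) (sub_add_cancel k d) _ _ rfl)

variable [GradedRing ℬ]

/-- The shift `{lam, p} M`: the group `M` with grading `({lam, p} M)_k = M_{k - (lam, p)}` and with
the action of a homogeneous `b` given by `(-1) ^ (p * b̄) b m`. -/
def shift (lam : Λ) (p : ZMod 2) (M : GSMod.{t, u, w} ℬ) : GSMod.{t, u, w} ℬ where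
  carrier := M.carrier
  module := Module.compHom M.carrier (signHom ℬ p)
  grading := fun k => M.grading (k - (lam, p))
  decomposition := shiftDecomposition M.grading (lam, p)
  smul_mem := by
    intro i k b m hb hm
    change signHom ℬ p b • m ∈ M.grading (i + k - (lam, p))
    rw [add_sub_assoc]
    refine M.smul_mem ?_ hm
    rw [signHom_of_mem ℬ p hb, Units.smul_def]
    exact zsmul_mem hb _

/-- The shift functor `{lam, p}`, which leaves morphisms unchanged. -/
def shiftFunctor (lam : Λ) (p : ZMod 2) : GSMod.{t, u, w} ℬ ⥤ GSMod.{t, u, w} ℬ where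
  obj M := shift lam p M
  map f :=
    { toLinearMap :=
        { toFun := f.toLinearMap
          map_add' := f.toLinearMap.map_add
          map_smul' := fun b m => f.toLinearMap.map_smul (signHom ℬ p b) m }
      map_mem := fun k m hm => f.map_mem (k - (lam, p)) m hm }

end Shift

end GSMod

/-! ### Graded superbimodules and tensor products -/

/-- Graded `(A₁, A₂)`-superbimodules; the right action of `A₂` is an action of `A₂ᵐᵒᵖ`. -/
structure GSBimod {A₁ : Type u₁} [Ring A₁] (𝒜₁ : Λ × ZMod 2 → AddSubgroup A₁)
    {A₂ : Type u₂} [Ring A₂] (𝒜₂ : Λ × ZMod 2 → AddSubgroup A₂) where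
  carrier : Type v
  [addCommGroup : AddCommGroup carrier]
  [leftModule : Module A₁ carrier]
  [rightModule : Module A₂ᵐᵒᵖ carrier]
  [smulCommClass : SMulCommClass A₁ A₂ᵐᵒᵖ carrier]
  grading : Λ × ZMod 2 → AddSubgroup carrier
  [decomposition : Decomposition grading]
  smul_mem : ∀ {i k : Λ × ZMod 2} {a : A₁} {x : carrier},
    a ∈ 𝒜₁ i → x ∈ grading k → a • x ∈ grading (i + k)
  op_smul_mem : ∀ {i k : Λ × ZMod 2} {a : A₂} {x : carrier},
    x ∈ grading i → a ∈ 𝒜₂ k → MulOpposite.op a • x ∈ grading (i + k)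

attribute [instance] GSBimod.addCommGroup GSBimod.leftModule GSBimod.rightModule
  GSBimod.smulCommClass GSBimod.decomposition

namespace GSBimod

variable {A₁ : Type u₁} [Ring A₁] {𝒜₁ : Λ × ZMod 2 → AddSubgroup A₁}
  {A₂ : Type u₂} [Ring A₂] {𝒜₂ : Λ × ZMod 2 → AddSubgroup A₂}

/-- The bimodule with underlying group the ring `C`, on which `A₁` acts by `a · c = f(a) c` and
`A₂` acts by `c · a = c g(a)`. -/
def ofHoms {C : Type v} [Ring C] {𝒞 : Λ × ZMod 2 → AddSubgroup C} [GradedRing 𝒞]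
    (f : 𝒜₁ →+*ᵍ 𝒞) (g : 𝒜₂ →+*ᵍ 𝒞) : GSBimod.{t, u₁, u₂, v} 𝒜₁ 𝒜₂ where
  carrier := C
  leftModule := Module.compHom C f.toRingHom
  rightModule := Module.compHom C (RingHom.op g.toRingHom)
  smulCommClass :=
    letI := Module.compHom C f.toRingHom
    letI := Module.compHom C (RingHom.op g.toRingHom)
    ⟨fun a b c => (mul_assoc (f a) c (g b.unop)).symm⟩
  grading := 𝒞
  smul_mem ha hx := SetLike.mul_mem_graded (f.map_mem ha) hx
  op_smul_mem hx ha := SetLike.mul_mem_graded hx (g.map_mem ha)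

variable (P : GSBimod.{t, u₁, u₂, v} 𝒜₁ 𝒜₂)

/-- The relations `x a ⊗ m = x ⊗ a m` that define `P ⊗_{A₂} M` as a quotient of `P ⊗_ℤ M`. The
set of relators is stable under the left action of `A₁`, so that their `A₁`-span is the subgroup
generated by them. -/
def tensorRel (M : GSMod.{t, u₂, w} 𝒜₂) : Submodule A₁ (P.carrier ⊗[ℤ] M.carrier) :=
  Submodule.span A₁ {z | ∃ (x : P.carrier) (a : A₂) (m : M.carrier),
    z = (MulOpposite.op a • x) ⊗ₜ[ℤ] m - x ⊗ₜ[ℤ] (a • m)}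

/-- The underlying group of `P ⊗_{A₂} M`, with its left action of `A₁`. -/
abbrev TensorCarrier (M : GSMod.{t, u₂, w} 𝒜₂) : Type (max v w) :=
  (P.carrier ⊗[ℤ] M.carrier) ⧸ P.tensorRel M

/-- The element `x ⊗ m` of `P ⊗_{A₂} M`. -/
def tmul (M : GSMod.{t, u₂, w} 𝒜₂) (x : P.carrier) (m : M.carrier) : P.TensorCarrier M :=
  (P.tensorRel M).mkQ (x ⊗ₜ[ℤ] m)

/-- The degree `d` part of `P ⊗_{A₂} M`: it is generated by the `x ⊗ m` with `x` and `m`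
homogeneous of degrees that add up to `d`. -/
def tensorGrading (M : GSMod.{t, u₂, w} 𝒜₂) (d : Λ × ZMod 2) : AddSubgroup (P.TensorCarrier M) :=
  AddSubgroup.closure {z | ∃ (i k : Λ × ZMod 2) (x : P.carrier) (m : M.carrier),
    i + k = d ∧ x ∈ P.grading i ∧ m ∈ M.grading k ∧ z = P.tmul M x m}

variable {P} in
theorem tmul_mem {M : GSMod.{t, u₂, w} 𝒜₂} {i k : Λ × ZMod 2} {x : P.carrier} {m : M.carrier}
    (hx : x ∈ P.grading i) (hm : m ∈ M.grading k) : P.tmul M x m ∈ P.tensorGrading M (i + k) :=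
  AddSubgroup.subset_closure ⟨i, k, x, m, rfl, hx, hm, rfl⟩

theorem tmul_add (M : GSMod.{t, u₂, w} 𝒜₂) (x : P.carrier) (m n : M.carrier) :
    P.tmul M x (m + n) = P.tmul M x m + P.tmul M x n := by
  simp only [tmul, TensorProduct.tmul_add, map_add]

theorem add_tmul (M : GSMod.{t, u₂, w} 𝒜₂) (x y : P.carrier) (m : M.carrier) :
    P.tmul M (x + y) m = P.tmul M x m + P.tmul M y m := by
  simp only [tmul, TensorProduct.add_tmul, map_add]

theorem op_smul_tmul (M : GSMod.{t, u₂, w} 𝒜₂) (x : P.carrier) (a : A₂) (m : M.carrier) :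
    P.tmul M (MulOpposite.op a • x) m = P.tmul M x (a • m) :=
  (Submodule.Quotient.eq _).2 (Submodule.subset_span ⟨x, a, m, rfl⟩)

theorem smul_tmul (M : GSMod.{t, u₂, w} 𝒜₂) (a : A₁) (x : P.carrier) (m : M.carrier) :
    a • P.tmul M x m = P.tmul M (a • x) m := rfl

/-- The additive map out of `P ⊗_{A₂} M` given by a balanced biadditive map. -/
def tensorLift (M : GSMod.{t, u₂, w} 𝒜₂) {G : Type*} [AddCommGroup G]
    (φ : P.carrier →+ M.carrier →+ G)
    (h : ∀ x (a : A₂) m, φ (MulOpposite.op a • x) m = φ x (a • m)) : P.TensorCarrier M →+ G :=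
  let L : P.carrier ⊗[ℤ] M.carrier →+ G :=
    TensorProduct.liftAddHom φ fun n x m => by simp
  QuotientAddGroup.lift (P.tensorRel M).toAddSubgroup L (by
    intro z hz
    refine Submodule.closure_induction (p := fun z _ => L z = 0) (map_zero L)
      (fun x y _ _ hx hy => by rw [map_add, hx, hy, add_zero]) ?_ hz
    rintro b _ ⟨x, a, m, rfl⟩
    rw [smul_sub, map_sub, sub_eq_zero, TensorProduct.smul_tmul', TensorProduct.smul_tmul',
      smul_comm b]
    exact h (b • x) a m)

theorem tensorLift_tmul (M : GSMod.{t, u₂, w} 𝒜₂) {G : Type*} [AddCommGroup G]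
    (φ : P.carrier →+ M.carrier →+ G)
    (h : ∀ x (a : A₂) m, φ (MulOpposite.op a • x) m = φ x (a • m)) (x : P.carrier)
    (m : M.carrier) : P.tensorLift M φ h (P.tmul M x m) = φ x m := rfl

theorem tensor_induction {M : GSMod.{t, u₂, w} 𝒜₂} {p : P.TensorCarrier M → Prop}
    (h0 : p 0) (hadd : ∀ y z, p y → p z → p (y + z)) (ht : ∀ x m, p (P.tmul M x m)) (z) : p z := by
  obtain ⟨z, rfl⟩ := (P.tensorRel M).mkQ_surjective z
  induction z using TensorProduct.induction_on with
  | zero => rwa [map_zero]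
  | tmul x m => exact ht x m
  | add y z hy hz => rw [map_add]; exact hadd _ _ hy hz

/-- The biadditive map `(x, m) ↦ x ⊗ m` on homogeneous parts. -/
def gradedTmul (M : GSMod.{t, u₂, w} 𝒜₂) (i k : Λ × ZMod 2) :
    P.grading i →+ M.grading k →+ P.tensorGrading M (i + k) :=
  AddMonoidHom.mk' (fun x => AddMonoidHom.mk' (fun m => ⟨P.tmul M x m, tmul_mem x.2 m.2⟩)
    (fun m n => Subtype.ext (P.tmul_add M x m n)))
    (fun x y => AddMonoidHom.ext fun m => Subtype.ext (P.add_tmul M x y m))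

/-- The biadditive map `(x, m) ↦ ∑ i k, x_i ⊗ m_k`, with `x_i ⊗ m_k` placed in degree `i + k`. -/
def tensorSplit (M : GSMod.{t, u₂, w} 𝒜₂) :
    P.carrier →+ M.carrier →+ ⨁ d, P.tensorGrading M d :=
  (AddMonoidHom.compHom.flip (decomposeAddEquiv M.grading).toAddMonoidHom).comp
    ((DirectSum.toAddMonoid fun i => AddMonoidHom.flip (DirectSum.toAddMonoid fun k =>
      AddMonoidHom.flip ((AddMonoidHom.compHom
        (DirectSum.of (fun d => P.tensorGrading M d) (i + k))).comp (P.gradedTmul M i k)))).comp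
    (decomposeAddEquiv P.grading).toAddMonoidHom)

theorem tensorSplit_of_mem (M : GSMod.{t, u₂, w} 𝒜₂) {i k : Λ × ZMod 2} {x : P.carrier}
    {m : M.carrier} (hx : x ∈ P.grading i) (hm : m ∈ M.grading k) :
    P.tensorSplit M x m =
      DirectSum.of (fun d => P.tensorGrading M d) (i + k) ⟨P.tmul M x m, tmul_mem hx hm⟩ := by
  simp [tensorSplit, gradedTmul, decompose_of_mem P.grading hx, decompose_of_mem M.grading hm]

variable [GradedRing 𝒜₂]

theorem tensorSplit_balanced (M : GSMod.{t, u₂, w} 𝒜₂) (x : P.carrier) (a : A₂) (m : M.carrier) :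
    P.tensorSplit M (MulOpposite.op a • x) m = P.tensorSplit M x (a • m) := by
  induction a using Decomposition.inductionOn 𝒜₂ with
  | zero => simp
  | add a b ha hb => rw [MulOpposite.op_add, add_smul, add_smul, map_add, map_add,
      AddMonoidHom.add_apply, ha, hb]
  | homogeneous a =>
    induction x using Decomposition.inductionOn P.grading with
    | zero => simp
    | add x y hx hy => rw [smul_add, map_add, map_add, AddMonoidHom.add_apply,
        AddMonoidHom.add_apply, hx, hy]
    | homogeneous x =>
      induction m using Decomposition.inductionOn M.grading with
      | zero => simp
      | add m n hm hn => rw [smul_add, map_add, map_add, hm, hn]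
      | homogeneous m =>
        rw [P.tensorSplit_of_mem M (P.op_smul_mem x.2 a.2) m.2,
          P.tensorSplit_of_mem M x.2 (M.smul_mem a.2 m.2)]
        exact of_congr _ (add_assoc _ _ _) _ _ (P.op_smul_tmul M x a m)

/-- `P ⊗_{A₂} M` is the direct sum of its homogeneous parts. -/
abbrev tensorDecomposition (M : GSMod.{t, u₂, w} 𝒜₂) : Decomposition (P.tensorGrading M) :=
  Decomposition.ofAddHom _ (P.tensorLift M (P.tensorSplit M) (P.tensorSplit_balanced M))
    (by
      ext z
      refine P.tensor_induction (p := fun z => ((DirectSum.coeAddMonoidHom (P.tensorGrading M)).comp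
          (P.tensorLift M (P.tensorSplit M) (P.tensorSplit_balanced M))) z = AddMonoidHom.id _ z)
        (by simp only [map_zero]) (fun y z hy hz => by rw [map_add, hy, hz, map_add])
        (fun x m => ?_) z
      rw [AddMonoidHom.comp_apply, tensorLift_tmul, AddMonoidHom.id_apply]
      induction x using Decomposition.inductionOn P.grading with
      | zero => simp [tmul]
      | add x y hx hy => rw [map_add, AddMonoidHom.add_apply, map_add, hx, hy, add_tmul]
      | homogeneous x =>
        induction m using Decomposition.inductionOn M.grading with
        | zero => simp [tmul]
        | add m n hm hn => rw [map_add, map_add, hm, hn, tmul_add]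
        | homogeneous m => rw [P.tensorSplit_of_mem M x.2 m.2, coeAddMonoidHom_of])
    (by
      ext d ⟨z, hz⟩ : 2
      simp only [AddMonoidHom.comp_apply, coeAddMonoidHom_of, AddMonoidHom.id_apply]
      induction hz using AddSubgroup.closure_induction with
      | mem z hz =>
        obtain ⟨i, k, x, m, rfl, hx, hm, rfl⟩ := hz
        rw [tensorLift_tmul, P.tensorSplit_of_mem M hx hm]
      | zero => rw [map_zero]; exact (map_zero _).symm
      | add y z hy hz ihy ihz => rw [map_add, ihy, ihz, ← map_add]; rfl
      | neg y hy ih => rw [map_neg, ih, ← map_neg]; rfl)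

/-- The graded supermodule `P ⊗_{A₂} M`. -/
def tensorObj (M : GSMod.{t, u₂, w} 𝒜₂) : GSMod.{t, u₁, max v w} 𝒜₁ where
  carrier := P.TensorCarrier M
  grading := P.tensorGrading M
  decomposition := P.tensorDecomposition M
  smul_mem := by
    intro i d a z ha hz
    induction hz using AddSubgroup.closure_induction with
    | mem z hz =>
      obtain ⟨k, l, x, m, rfl, hx, hm, rfl⟩ := hz
      rw [smul_tmul, ← add_assoc]
      exact tmul_mem (P.smul_mem ha hx) hm
    | zero => rw [smul_zero]; exact zero_mem _
    | add y z _ _ hy hz => rw [smul_add]; exact add_mem hy hz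
    | neg y _ hy => rw [smul_neg]; exact neg_mem hy

/-- The map `x ⊗ m ↦ x ⊗ f(m)`. -/
def tensorMap {M N : GSMod.{t, u₂, w} 𝒜₂} (f : M ⟶ N) :
    P.TensorCarrier M →ₗ[A₁] P.TensorCarrier N :=
  Submodule.mapQ (P.tensorRel M) (P.tensorRel N)
    (TensorProduct.AlgebraTensorModule.lTensor A₁ P.carrier (f.toLinearMap.restrictScalars ℤ))
    (by
      rw [tensorRel, Submodule.span_le]
      rintro _ ⟨x, a, m, rfl⟩
      exact Submodule.subset_span ⟨x, a, f.toLinearMap m, by simp⟩)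

theorem tensorMap_tmul {M N : GSMod.{t, u₂, w} 𝒜₂} (f : M ⟶ N) (x : P.carrier) (m : M.carrier) :
    P.tensorMap f (P.tmul M x m) = P.tmul N x (f.toLinearMap m) := rfl

theorem tensorMap_mem {M N : GSMod.{t, u₂, w} 𝒜₂} (f : M ⟶ N) (d : Λ × ZMod 2)
    (z : P.TensorCarrier M) (hz : z ∈ P.tensorGrading M d) :
    P.tensorMap f z ∈ P.tensorGrading N d := by
  induction hz using AddSubgroup.closure_induction with
  | mem z hz =>
    obtain ⟨i, k, x, m, rfl, hx, hm, rfl⟩ := hz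
    exact tmul_mem hx (f.map_mem k m hm)
  | zero => rw [map_zero]; exact zero_mem _
  | add y z _ _ hy hz => rw [map_add]; exact add_mem hy hz
  | neg y _ hy => rw [map_neg]; exact neg_mem hy

theorem tensorMap_id (M : GSMod.{t, u₂, w} 𝒜₂) : P.tensorMap (𝟙 M) = LinearMap.id :=
  LinearMap.ext fun z => P.tensor_induction (p := fun z => P.tensorMap (𝟙 M) z = z) (map_zero _)
    (fun y z hy hz => by rw [map_add, hy, hz]) (fun _ _ => rfl) z

theorem tensorMap_comp {L M N : GSMod.{t, u₂, w} 𝒜₂} (f : L ⟶ M) (g : M ⟶ N) :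
    P.tensorMap (f ≫ g) = (P.tensorMap g).comp (P.tensorMap f) :=
  LinearMap.ext fun z => P.tensor_induction
    (p := fun z => P.tensorMap (f ≫ g) z = P.tensorMap g (P.tensorMap f z))
    (by simp only [map_zero]) (fun y z hy hz => by simp only [map_add, hy, hz])
    (fun _ _ => rfl) z

/-- The functor `P ⊗_{A₂} -`. -/
def tensorFunctor : GSMod.{t, u₂, w} 𝒜₂ ⥤ GSMod.{t, u₁, max v w} 𝒜₁ where
  obj M := P.tensorObj M
  map f := ⟨P.tensorMap f, P.tensorMap_mem f⟩
  map_id M := GSMod.Hom.ext (P.tensorMap_id M)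
  map_comp f g := GSMod.Hom.ext (P.tensorMap_comp f g)

end GSBimod

/-! ### Twisted Frobenius extensions -/

section Frobenius

variable {A : Type u₁} [Ring A] {𝒜 : Λ × ZMod 2 → AddSubgroup A} [GradedRing 𝒜]
  {B : Type u₂} [Ring B] {ℬ : Λ × ZMod 2 → AddSubgroup B} [GradedRing ℬ]

/-- `tr` is a trace map that makes `A` an `(α, β)`-Frobenius extension of degree `(-lam, p)` of
the subring `j : B → A`. -/
structure IsTwistedFrobeniusWith (j : ℬ →+*ᵍ 𝒜) (α : 𝒜 →+*ᵍ 𝒜) (β : ℬ →+*ᵍ ℬ) (lam : Λ)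
    (p : ZMod 2) (tr : A →+ B) : Prop where
  /-- `B` is a subring of `A`; `α` and `β` are automorphisms. -/
  injective : Function.Injective j
  bijective_left : Function.Bijective α
  bijective_right : Function.Bijective β
  /-- `A` is finitely generated and projective as a left `B`-module. -/
  finite : Module.Finite B (GSMod.ofHom j).carrier
  projective : Module.Projective B (GSMod.ofHom j).carrier
  /-- `tr` is a morphism of `(B, B)`-bimodules from `^β_B A_B^α` to `{lam, p} B`. -/
  map_mem : ∀ (i : Λ × ZMod 2) (a : A), a ∈ 𝒜 i → tr a ∈ ℬ (i - (lam, p))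
  map_left : ∀ (i : Λ × ZMod 2) (b : B) (a : A), b ∈ ℬ i →
    tr (j (β b) * a) = ((-1 : ℤˣ) ^ (p * i.2)) • (b * tr a)
  map_right : ∀ (a : A) (b : B), tr (a * α (j b)) = tr a * b
  /-- If `tr (A a) = 0`, then `a = 0`. -/
  eq_zero : ∀ a : A, (∀ c : A, tr (c * a) = 0) → a = 0
  /-- Every `φ` in `HOM_B(^β_B A, {lam, p} B)` is of the form `tr ∘ ʳa`. -/
  exists_eq : ∀ φ : A →+ B,
    φ ∈ GSMod.HOM (GSMod.ofHom (j.comp β)) (GSMod.shift lam p (GSMod.ofHom (GradedRingHom.id ℬ))) →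
      ∃ a : A, φ = tr.comp (rightOp 𝒜 a)

/-- `A` is an `(α, β)`-Frobenius extension of degree `(-lam, p)` of the subring `j : B → A`. -/
def IsTwistedFrobenius (j : ℬ →+*ᵍ 𝒜) (α : 𝒜 →+*ᵍ 𝒜) (β : ℬ →+*ᵍ ℬ) (lam : Λ)
    (p : ZMod 2) : Prop :=
  ∃ tr : A →+ B, IsTwistedFrobeniusWith j α β lam p tr

/-- `tr` is a trace map that makes `A` an untwisted Frobenius extension of degree `(-lam, p)`. -/
abbrev IsFrobeniusWith (j : ℬ →+*ᵍ 𝒜) (lam : Λ) (p : ZMod 2) (tr : A →+ B) : Prop :=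
  IsTwistedFrobeniusWith j (GradedRingHom.id 𝒜) (GradedRingHom.id ℬ) lam p tr

/-- `ψ` is the Nakayama automorphism of an untwisted Frobenius extension with trace map
`tr : A → B`, in the case where the centralizer of the subring `B` is all of `A`. -/
structure IsNakayama (tr : A →+ B) (ψ : 𝒜 →+*ᵍ 𝒜) : Prop where
  bijective : Function.Bijective ψ
  trace_mul : ∀ (i k : Λ × ZMod 2) (a c : A), a ∈ 𝒜 i → c ∈ 𝒜 k →
    tr (c * a) = ((-1 : ℤˣ) ^ (i.2 * k.2)) • tr (a * ψ c)

/-- `x` and `y` are dual sets of generators of `A` over the subring `j : B → A`, with respect to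
a trace map `tr` of degree `(-lam, p)`; the degree of `x s` is `dx s`. -/
structure IsDualGenerators (j : ℬ →+*ᵍ 𝒜) (lam : Λ) (p : ZMod 2) (tr : A →+ B) {n : ℕ}
    (dx : Fin n → Λ × ZMod 2) (x y : Fin n → A) : Prop where
  mem_left : ∀ s, x s ∈ 𝒜 (dx s)
  mem_right : ∀ s, y s ∈ 𝒜 ((lam, p) - dx s)
  left_expansion : ∀ (i : Λ × ZMod 2) (a : A), a ∈ 𝒜 i →
    a = ((-1 : ℤˣ) ^ (p * i.2)) •
      ∑ s, ((-1 : ℤˣ) ^ (p * (dx s).2)) • (j (tr (a * y s)) * x s)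
  right_expansion : ∀ a : A, a = ∑ s, y s * j (tr (x s * a))

/-- The induction functor `_A A_B ⊗_B -`. -/
def inductionFunctor (j : ℬ →+*ᵍ 𝒜) : GSMod.{t, u₂, max u₁ w} ℬ ⥤ GSMod.{t, u₁, max u₁ w} 𝒜 :=
  (GSBimod.ofHoms (GradedRingHom.id 𝒜) j).tensorFunctor

/-- The shifted twisted restriction functor `{lam, p} ^β_B A^α_A ⊗_A -`. -/
def shiftedTwistedRestriction (j : ℬ →+*ᵍ 𝒜) (α : 𝒜 →+*ᵍ 𝒜) (β : ℬ →+*ᵍ ℬ) (lam : Λ)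
    (p : ZMod 2) : GSMod.{t, u₁, max u₁ w} 𝒜 ⥤ GSMod.{t, u₂, max u₁ w} ℬ :=
  (GSBimod.ofHoms (j.comp β) α).tensorFunctor ⋙ GSMod.shiftFunctor lam p

end Frobenius

end NestedFrobenius

end

/-! Every Frobenius extension has dual sets of generators `x`, `y`: homogeneous generators `x` come
with homogeneous coordinate functionals (`exists_homogeneous_dualBasis`), (T2) represents these by
elements `y`, and (T1) gives the second expansion (`exists_dualGenerators`).

Since `R` supercommutes with `A`, for homogeneous `c` the functional sending `a` to the signed value
of `trA (c * a)` has the left linearity of `trA`, so (T2) represents it as `trA (a * c')`. By (T1),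
`c'` is unique, and uniqueness makes `c ↦ c'` a ring homomorphism fixing `R`. Nondegeneracy on the
other side gives injectivity; dual sets give surjectivity.

The trace `tr : A → B` is determined by `trB (tr a * b) = trA (a * ψA b)` (`trace_nestedTrace_mul`).
Taking `b = 1` gives `trB ∘ tr = trA`. Right linearity follows from nondegeneracy of `trB`; left
linearity follows by moving `b` cyclically through `trB`, then `ψB b` through `trA`. (T1) passes
from `trA` to `tr`. For (T2), composing a functional with `trB` gives one on `A` over `R`,
represented by some `a` via `trA`; nondegeneracy of `trB` shows that `a` already represents the
original functional via `tr`.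

The adjunction holds for every twisted Frobenius extension (`nonempty_adjunction`). Its counit
evaluates the trace, its unit inserts the Casimir element of a pair of dual sets, and the triangle
identities are the two expansions of `exists_dualGenerators`.

Signs are carried by the automorphisms `signHom` and the operator `rightOp`, so that most identities
make sense for inhomogeneous elements and can be checked on homogeneous ones by additivity. -/

noncomputable section

namespace NestedFrobenius

variable {Λ : Type t} [AddCommGroup Λ] [DecidableEq Λ]

/-! ### Homogeneous components -/

section Components

variable {ι : Type*} [DecidableEq ι] {M : Type*} [AddCommGroup M] (ℳ : ι → AddSubgroup M)
  [Decomposition ℳ]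

/-- The projection of `M` onto its homogeneous part of degree `i`, as an endomorphism of `M`. -/
def component (i : ι) : M →+ M :=
  ((ℳ i).subtype.comp (DFinsupp.evalAddMonoidHom i)).comp (decomposeAddEquiv ℳ).toAddMonoidHom

theorem component_apply (i : ι) (m : M) : component ℳ i m = decompose ℳ m i := rfl

theorem component_mem (i : ι) (m : M) : component ℳ i m ∈ ℳ i := (decompose ℳ m i).2

theorem component_of_mem {i : ι} {m : M} (hm : m ∈ ℳ i) : component ℳ i m = m :=
  decompose_of_mem_same ℳ hm

theorem component_of_mem_ne {i k : ι} {m : M} (hm : m ∈ ℳ i) (h : i ≠ k) :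
    component ℳ k m = 0 :=
  decompose_of_mem_ne ℳ hm h

theorem eq_of_component_eq {m n : M} (h : ∀ i, component ℳ i m = component ℳ i n) : m = n :=
  (decompose ℳ).injective (DFinsupp.ext fun i => Subtype.ext (h i))

theorem addMonoidHom_eq_of_homogeneous {N : Type*} [AddCommGroup N] {f g : M →+ N}
    (h : ∀ i, ∀ m ∈ ℳ i, f m = g m) (m : M) : f m = g m := by
  induction m using Decomposition.inductionOn ℳ with
  | zero => simp
  | add a b ha hb => rw [map_add, map_add, ha, hb]
  | homogeneous a => exact h _ _ a.2

end Components

section HomogeneousPart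

variable {Γ : Type*} [AddCommGroup Γ] [DecidableEq Γ] {M N : Type*} [AddCommGroup M]
  [AddCommGroup N] (ℳ : Γ → AddSubgroup M) [Decomposition ℳ] (𝒩 : Γ → AddSubgroup N)
  [Decomposition 𝒩]

variable {ℳ 𝒩} in
/-- A map of degree `d` commutes with the projections onto homogeneous parts. -/
theorem component_map {d : Γ} {f : M →+ N} (hf : ∀ i, ∀ m ∈ ℳ i, f m ∈ 𝒩 (i + d)) (i : Γ)
    (m : M) : component 𝒩 (i + d) (f m) = f (component ℳ i m) := by
  refine addMonoidHom_eq_of_homogeneous ℳ (f := (component 𝒩 (i + d)).comp f)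
    (g := f.comp (component ℳ i)) (fun k m hm => ?_) m
  simp only [AddMonoidHom.comp_apply]
  by_cases h : k = i
  · subst h
    rw [component_of_mem _ (hf _ _ hm), component_of_mem _ hm]
  · rw [component_of_mem_ne _ (hf _ _ hm) (fun h' => h (add_right_cancel h')),
      component_of_mem_ne _ hm h, map_zero]

/-- The part of degree `d` of an additive map between graded groups. -/
def degreePart (d : Γ) (f : M →+ N) : M →+ N :=
  (DirectSum.toAddMonoid fun i => ((component 𝒩 (i + d)).comp f).comp (ℳ i).subtype).comp
    (decomposeAddEquiv ℳ).toAddMonoidHom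

theorem degreePart_of_mem (d : Γ) (f : M →+ N) {i : Γ} {m : M} (hm : m ∈ ℳ i) :
    degreePart ℳ 𝒩 d f m = component 𝒩 (i + d) (f m) := by
  simp [degreePart, decompose_of_mem ℳ hm]

end HomogeneousPart

/-- A degree-preserving homomorphism commutes with projections, so `a` and its component of degree
`i` have the same image. -/
theorem mem_of_map_mem_of_bijective {Γ A B : Type*} [Ring A] [Ring B] [AddCommGroup Γ]
    [DecidableEq Γ] {𝒜 : Γ → AddSubgroup A} {ℬ : Γ → AddSubgroup B} [GradedRing 𝒜] [GradedRing ℬ]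
    {f : 𝒜 →+*ᵍ ℬ} (hf : Function.Bijective f) {i : Γ} {a : A} (ha : f a ∈ ℬ i) : a ∈ 𝒜 i := by
  have h : f (component 𝒜 i a) = f a := by
    rw [component_apply, GradedRingHom.map_directSumDecompose, decompose_of_mem_same ℬ ha]
  rw [← hf.1 h]
  exact component_mem _ _ _

/-! ### Homogeneous dual bases of graded projective modules -/

namespace GSMod

variable {B : Type u} [Ring B] {ℬ : Λ × ZMod 2 → AddSubgroup B} [GradedRing ℬ]

theorem component_smul_right (M : GSMod.{t, u, w} ℬ) {k : Λ × ZMod 2} {m : M.carrier}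
    (hm : m ∈ M.grading k) (i : Λ × ZMod 2) (b : B) :
    component M.grading (i + k) (b • m) = component ℬ i b • m :=
  component_map (f := (smulAddHom B M.carrier).flip m) (fun _ _ hb => M.smul_mem hb hm) i b

theorem exists_homogeneous_generators (M : GSMod.{t, u, w} ℬ) [Module.Finite B M.carrier] :
    ∃ (n : ℕ) (d : Fin n → Λ × ZMod 2) (e : Fin n → M.carrier),
      (∀ s, e s ∈ M.grading (d s)) ∧ Submodule.span B (Set.range e) = ⊤ := by
  classical
  obtain ⟨S, hS⟩ := Module.Finite.fg_top (R := B) (M := M.carrier)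
  -- The degree is stored with each component, so that it can be read off after reindexing by `Fin`.
  let T : Finset ((Λ × ZMod 2) × M.carrier) :=
    S.biUnion fun m => (decompose M.grading m).support.image fun i => (i, component M.grading i m)
  have hT : ∀ z ∈ T, z.2 ∈ M.grading z.1 := by
    intro z hz
    simp only [T, Finset.mem_biUnion, Finset.mem_image] at hz
    obtain ⟨m, -, i, -, rfl⟩ := hz
    exact component_mem _ _ _
  let ε := T.equivFin.symm
  refine ⟨T.card, fun s => (ε s).1.1, fun s => (ε s).1.2, fun s => hT _ (ε s).2, ?_⟩
  rw [eq_top_iff, ← hS, Submodule.span_le]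
  intro m hm
  rw [← sum_support_decompose M.grading m]
  refine Submodule.sum_mem _ fun i hi => Submodule.subset_span ?_
  have hz : (i, component M.grading i m) ∈ T := by
    simp only [T, Finset.mem_biUnion, Finset.mem_image]
    exact ⟨m, hm, i, hi, rfl⟩
  exact ⟨ε.symm ⟨_, hz⟩, by simp [component_apply]⟩

/-- A graded module that is finitely generated and projective has a finite homogeneous
dual basis. -/
theorem exists_homogeneous_dualBasis (M : GSMod.{t, u, w} ℬ) [Module.Finite B M.carrier]
    [Module.Projective B M.carrier] :
    ∃ (n : ℕ) (d : Fin n → Λ × ZMod 2) (e : Fin n → M.carrier) (f : Fin n → M.carrier →+ B),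
      (∀ s, e s ∈ M.grading (d s)) ∧
      (∀ s i, ∀ m ∈ M.grading i, f s m ∈ ℬ (i - d s)) ∧
      (∀ s (b : B) m, f s (b • m) = b * f s m) ∧
      ∀ m, m = ∑ s, f s m • e s := by
  obtain ⟨n, d, e, he, hspan⟩ := M.exists_homogeneous_generators
  obtain ⟨g, hg⟩ := Module.projective_lifting_property (Fintype.linearCombination B e)
    (LinearMap.id : M.carrier →ₗ[B] M.carrier)
    (LinearMap.range_eq_top.1 (by rw [Fintype.range_linearCombination, hspan]))
  let c (s : Fin n) : M.carrier →+ B := ((LinearMap.proj s).comp g).toAddMonoidHom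
  -- The coordinates of a splitting need not be homogeneous; only their part of degree `-d s` is
  -- kept.
  let f (s : Fin n) : M.carrier →+ B := degreePart M.grading ℬ (-d s) (c s)
  have hf (s : Fin n) {i : Λ × ZMod 2} {m : M.carrier} (hm : m ∈ M.grading i) :
      f s m = component ℬ (i - d s) (g m s) := by
    rw [sub_eq_add_neg]
    exact degreePart_of_mem _ _ _ _ hm
  refine ⟨n, d, e, f, he, fun s i m hm => by rw [hf s hm]; exact component_mem _ _ _, ?_, ?_⟩
  · intro s b m
    refine addMonoidHom_eq_of_homogeneous M.grading
      (f := (f s).comp (DistribSMul.toAddMonoidHom M.carrier b))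
      (g := (AddMonoidHom.mulLeft b).comp (f s)) (fun i m hm => ?_) m
    refine addMonoidHom_eq_of_homogeneous ℬ
      (f := (f s).comp ((smulAddHom B M.carrier).flip m))
      (g := AddMonoidHom.mulRight (f s m)) (fun k b hb => ?_) b
    change f s (b • m) = b * f s m
    rw [hf s (M.smul_mem hb hm), hf s hm, map_smul, Pi.smul_apply, smul_eq_mul, add_sub_assoc]
    exact coe_decompose_mul_add_of_left_mem ℬ hb
  · intro m
    refine addMonoidHom_eq_of_homogeneous M.grading (f := AddMonoidHom.id _)
      (g := ∑ s, ((smulAddHom B M.carrier).flip (e s)).comp (f s)) (fun i m hm => ?_) m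
      |>.trans ?_
    · have h : m = ∑ s, g m s • e s := (DFunLike.congr_fun hg m).symm
      rw [AddMonoidHom.id_apply, AddMonoidHom.finsetSum_apply]
      -- Projecting the expansion of a homogeneous `m` to its own degree retains precisely the
      -- chosen parts of the coordinates.
      conv_lhs => rw [← component_of_mem _ hm, h, map_sum]
      refine Finset.sum_congr rfl fun s _ => ?_
      have := M.component_smul_right (he s) (i - d s) (g m s)
      rw [sub_add_cancel] at this
      rw [this, ← hf s hm]
      rfl
    · simp [AddMonoidHom.finsetSum_apply]

end GSMod

/-! ### Sign automorphisms -/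

section SignHom

variable {A : Type*} [Ring A] {𝒜 : Λ × ZMod 2 → AddSubgroup A} [GradedRing 𝒜]
  {B : Type*} [Ring B] {ℬ : Λ × ZMod 2 → AddSubgroup B} [GradedRing ℬ]

theorem units_smul_mem {M : Type*} [AddCommGroup M] (S : AddSubgroup M) (e : ℤˣ) {m : M}
    (hm : m ∈ S) : e • m ∈ S := by
  rw [Units.smul_def]
  exact zsmul_mem hm _

theorem map_units_smul {M N F : Type*} [AddCommGroup M] [AddCommGroup N] [FunLike F M N]
    [AddMonoidHomClass F M N] (f : F) (e : ℤˣ) (m : M) : f (e • m) = e • f m := by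
  rw [Units.smul_def, Units.smul_def, map_zsmul]

theorem neg_one_uzpow_smul_smul {M : Type*} [AddCommGroup M] (x y : ZMod 2) (m : M) :
    ((-1 : ℤˣ) ^ x) • ((-1 : ℤˣ) ^ y) • m = ((-1 : ℤˣ) ^ (x + y)) • m := by
  rw [smul_smul, uzpow_add]

theorem neg_one_uzpow_smul_self {M : Type*} [AddCommGroup M] (x : ZMod 2) (m : M) :
    ((-1 : ℤˣ) ^ x) • ((-1 : ℤˣ) ^ x) • m = m := by
  rw [neg_one_uzpow_smul_smul, CharTwo.add_self_eq_zero, uzpow_zero, one_smul]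

theorem gradedRingHom_mem (f : ℬ →+*ᵍ 𝒜) {i : Λ × ZMod 2} {b : B} (hb : b ∈ ℬ i) : f b ∈ 𝒜 i :=
  f.map_mem hb

theorem signHom_mem (p : ZMod 2) {i : Λ × ZMod 2} {a : A} (ha : a ∈ 𝒜 i) :
    signHom 𝒜 p a ∈ 𝒜 i := by
  rw [signHom_of_mem 𝒜 p ha]
  exact units_smul_mem _ _ ha

theorem signHom_signHom (p q : ZMod 2) (a : A) :
    signHom 𝒜 p (signHom 𝒜 q a) = signHom 𝒜 (p + q) a := by
  refine addMonoidHom_eq_of_homogeneous 𝒜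
    (f := ((signHom 𝒜 p).comp (signHom 𝒜 q)).toAddMonoidHom)
    (g := (signHom 𝒜 (p + q)).toAddMonoidHom) (fun i a ha => ?_) a
  change signHom 𝒜 p (signHom 𝒜 q a) = signHom 𝒜 (p + q) a
  rw [signHom_of_mem _ _ (signHom_mem q ha), signHom_of_mem _ _ ha, signHom_of_mem _ _ ha,
    neg_one_uzpow_smul_smul, add_mul]

theorem signHom_zero (a : A) : signHom 𝒜 0 a = a :=
  addMonoidHom_eq_of_homogeneous 𝒜 (f := (signHom 𝒜 0).toAddMonoidHom) (g := AddMonoidHom.id A)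
    (fun i a ha => (signHom_of_mem 𝒜 0 ha).trans (by simp)) a

theorem signHom_signHom_self (p : ZMod 2) (a : A) : signHom 𝒜 p (signHom 𝒜 p a) = a := by
  rw [signHom_signHom, CharTwo.add_self_eq_zero, signHom_zero]

theorem map_signHom (f : ℬ →+*ᵍ 𝒜) (p : ZMod 2) (b : B) :
    f (signHom ℬ p b) = signHom 𝒜 p (f b) := by
  refine addMonoidHom_eq_of_homogeneous ℬ (f := (f.toRingHom.comp (signHom ℬ p)).toAddMonoidHom)
    (g := ((signHom 𝒜 p).comp f.toRingHom).toAddMonoidHom) (fun i b hb => ?_) b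
  change f (signHom ℬ p b) = signHom 𝒜 p (f b)
  rw [signHom_of_mem _ _ hb, signHom_of_mem _ _ (gradedRingHom_mem f hb), map_units_smul]

end SignHom

/-! ### Consequences of the Frobenius property -/

namespace IsTwistedFrobeniusWith

variable {A : Type u₁} [Ring A] {𝒜 : Λ × ZMod 2 → AddSubgroup A} [GradedRing 𝒜]
  {B : Type u₂} [Ring B] {ℬ : Λ × ZMod 2 → AddSubgroup B} [GradedRing ℬ]
  {j : ℬ →+*ᵍ 𝒜} {α : 𝒜 →+*ᵍ 𝒜} {β : ℬ →+*ᵍ ℬ} {lam : Λ} {p : ZMod 2} {tr : A →+ B}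

/-- The sign is absorbed into `signHom`, which removes the homogeneity assumption on `b`. -/
theorem trace_left_mul (h : IsTwistedFrobeniusWith j α β lam p tr) (b : B) (a : A) :
    tr (j (β b) * a) = signHom ℬ p b * tr a := by
  refine addMonoidHom_eq_of_homogeneous ℬ
    (f := tr.comp ((AddMonoidHom.mulRight a).comp (j.comp β).toRingHom.toAddMonoidHom))
    (g := (AddMonoidHom.mulRight (tr a)).comp (signHom ℬ p).toAddMonoidHom) (fun i b hb => ?_) b
  change tr (j (β b) * a) = signHom ℬ p b * tr a
  rw [h.map_left i b a hb, signHom_of_mem _ _ hb, smul_mul_assoc]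

theorem eq_of_trace_mul_eq (h : IsTwistedFrobeniusWith j α β lam p tr) {a a' : A}
    (haa : ∀ c, tr (c * a) = tr (c * a')) : a = a' :=
  sub_eq_zero.1 (h.eq_zero _ fun c => by rw [mul_sub, map_sub, haa, sub_self])

/-- A homogeneous map with the same left linearity as `tr` is of the form `c ↦ tr (c a)`. -/
theorem exists_eq_trace_mul (h : IsTwistedFrobeniusWith j α β lam p tr) (d : Λ × ZMod 2)
    (φ : A →+ B) (hmem : ∀ i, ∀ c ∈ 𝒜 i, φ c ∈ ℬ (d + i - (lam, p)))
    (hlin : ∀ b c, φ (j (β b) * c) = signHom ℬ p b * φ c) :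
    ∃ a ∈ 𝒜 d, ∀ c, φ c = tr (c * a) := by
  -- A member of `HOM` of degree `d` has an extra sign in its linearity rule; composing with the
  -- sign twist by the parity of `d` produces it.
  have hHOM : φ.comp (signTwist 𝒜 d.2) ∈ GSMod.homDeg (GSMod.ofHom (j.comp β))
      (GSMod.shift lam p (GSMod.ofHom (GradedRingHom.id ℬ))) d := by
    refine ⟨fun i c hc => hmem i _ (signHom_mem (𝒜 := 𝒜) d.2 hc), fun i b (c : A) hb => ?_⟩
    change φ (signHom 𝒜 d.2 (j (β b) * c)) =
      ((-1 : ℤˣ) ^ (d.2 * i.2)) • (signHom ℬ p b * φ (signHom 𝒜 d.2 c))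
    rw [map_mul, signHom_of_mem _ _ (gradedRingHom_mem j (gradedRingHom_mem β hb)),
      smul_mul_assoc, map_units_smul, hlin]
  obtain ⟨a, ha⟩ := h.exists_eq _ (AddSubgroup.mem_iSup_of_mem d hHOM)
  -- The element given by (T2) may be inhomogeneous. As `tr` is homogeneous and `φ` has degree
  -- matching `d`, only the component of degree `d` contributes.
  refine ⟨component 𝒜 d a, component_mem _ _ _, ?_⟩
  refine addMonoidHom_eq_of_homogeneous 𝒜
    (g := tr.comp (AddMonoidHom.mulRight (component 𝒜 d a))) fun i c hc => ?_
  have hdeg : ∀ k, ∀ a ∈ 𝒜 k, tr (rightOp 𝒜 a c) ∈ ℬ (k + (i - (lam, p))) := by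
    intro k a ha
    rw [rightOp_of_mem 𝒜 ha hc, map_units_smul, ← add_sub_assoc, add_comm k i]
    exact units_smul_mem _ _ (h.map_mem _ _ (SetLike.mul_mem_graded hc ha))
  have hc' := component_map (f := (tr.comp ((rightOp 𝒜).flip c))) hdeg d a
  have hφ : φ (signTwist 𝒜 d.2 c) = tr (rightOp 𝒜 a c) := DFunLike.congr_fun ha c
  simp only [AddMonoidHom.comp_apply, AddMonoidHom.flip_apply] at hc'
  rw [← hφ, rightOp_of_mem 𝒜 (component_mem 𝒜 d a) hc, signTwist_of_mem _ _ hc,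
    map_units_smul, map_units_smul, map_units_smul,
    component_of_mem _ (by rw [← add_sub_assoc]; exact hmem i c hc)] at hc'
  exact smul_left_cancel _ hc'

/-- Dual sets of generators of a twisted Frobenius extension. -/
theorem exists_dualGenerators (h : IsTwistedFrobeniusWith j α β lam p tr) :
    ∃ (n : ℕ) (d : Fin n → Λ × ZMod 2) (x y : Fin n → A),
      (∀ s, x s ∈ 𝒜 (d s)) ∧ (∀ s, y s ∈ 𝒜 ((lam, p) - d s)) ∧
      (∀ a, a = ∑ s, j (β (signHom ℬ p (tr (a * y s)))) * x s) ∧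
      ∀ a, a = ∑ s, y s * α (j (tr (x s * a))) := by
  have := h.finite
  have := h.projective
  obtain ⟨n, d, x, f, hx, hf, hfl, hsum⟩ :
      ∃ (n : ℕ) (d : Fin n → Λ × ZMod 2) (x : Fin n → A) (f : Fin n → A →+ B),
        (∀ s, x s ∈ 𝒜 (d s)) ∧ (∀ s i, ∀ a ∈ 𝒜 i, f s a ∈ ℬ (i - d s)) ∧
        (∀ s (b : B) (a : A), f s (j b * a) = b * f s a) ∧ ∀ a, a = ∑ s, j (f s a) * x s :=
    (GSMod.ofHom j).exists_homogeneous_dualBasis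
  let βe : B ≃+* B := RingEquiv.ofBijective β.toRingHom h.bijective_right
  have hβe (b : B) : β (βe.symm b) = b := βe.apply_symm_apply b
  -- The coordinates are `B`-linear for the untwisted action; undoing `β` and the parity sign gives
  -- them the left linearity of `tr`, so that (T2) applies.
  let φ (s : Fin n) : A →+ B := (βe.symm.toRingHom.comp (signHom ℬ p)).toAddMonoidHom.comp (f s)
  have hφ (s : Fin n) (a : A) : β (signHom ℬ p (φ s a)) = f s a := by
    rw [map_signHom]
    change signHom ℬ p (β (βe.symm (signHom ℬ p (f s a)))) = _
    rw [hβe, signHom_signHom_self]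
  have hinj : Function.Injective fun b : B => β (signHom ℬ p b) :=
    h.bijective_right.1.comp (Function.LeftInverse.injective (signHom_signHom_self (𝒜 := ℬ) p))
  have hy (s : Fin n) : ∃ y ∈ 𝒜 ((lam, p) - d s), ∀ c, φ s c = tr (c * y) := by
    refine h.exists_eq_trace_mul _ _ (fun i c hc => ?_) fun b c => ?_
    · refine mem_of_map_mem_of_bijective h.bijective_right ?_
      have : (lam, p) - d s + i - (lam, p) = i - d s := by abel
      rw [this]
      change β (βe.symm (signHom ℬ p (f s c))) ∈ _
      rw [hβe]
      exact signHom_mem p (hf s i c hc)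
    · refine hinj ?_
      change β (signHom ℬ p _) = β (signHom ℬ p _)
      rw [map_mul (signHom ℬ p), map_mul β, hφ, hφ, signHom_signHom_self]
      exact hfl s (β b) c
  choose y hy hφy using hy
  have hleft (a : A) : a = ∑ s, j (β (signHom ℬ p (tr (a * y s)))) * x s := by
    refine (hsum a).trans (Finset.sum_congr rfl fun s _ => ?_)
    rw [← hφy, hφ]
  -- The second expansion is tested by `tr (c * _)`: expanding `c` by the first one makes both sides
  -- equal term by term.
  refine ⟨n, d, x, y, hx, hy, hleft, fun a => h.eq_of_trace_mul_eq fun c => ?_⟩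
  conv_lhs => rw [hleft c]
  simp only [Finset.sum_mul, Finset.mul_sum, map_sum, mul_assoc, h.trace_left_mul]
  refine Finset.sum_congr rfl fun s _ => ?_
  rw [← mul_assoc c, h.map_right, signHom_signHom_self]

end IsTwistedFrobeniusWith

/-! ### Nakayama automorphisms -/

section RightOp

variable {A : Type*} [Ring A] {𝒜 : Λ × ZMod 2 → AddSubgroup A} [GradedRing 𝒜]
  {R : Type*} [Ring R] {ℛ : Λ × ZMod 2 → AddSubgroup R} [GradedRing ℛ]

/-- When only one argument is homogeneous, the Koszul sign becomes the sign automorphism applied to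
the other. -/
theorem rightOp_of_mem_left {i : Λ × ZMod 2} {a : A} (ha : a ∈ 𝒜 i) (m : A) :
    rightOp 𝒜 a m = signHom 𝒜 i.2 m * a := by
  refine addMonoidHom_eq_of_homogeneous 𝒜 (f := rightOp 𝒜 a)
    (g := (AddMonoidHom.mulRight a).comp (signHom 𝒜 i.2).toAddMonoidHom) (fun k m hm => ?_) m
  change rightOp 𝒜 a m = signHom 𝒜 i.2 m * a
  rw [rightOp_of_mem 𝒜 ha hm, signHom_of_mem _ _ hm, smul_mul_assoc]

theorem rightOp_of_mem_right {k : Λ × ZMod 2} {m : A} (hm : m ∈ 𝒜 k) (a : A) :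
    rightOp 𝒜 a m = m * signHom 𝒜 k.2 a := by
  refine addMonoidHom_eq_of_homogeneous 𝒜 (f := (rightOp 𝒜).flip m)
    (g := (AddMonoidHom.mulLeft m).comp (signHom 𝒜 k.2).toAddMonoidHom) (fun i a ha => ?_) a
  change rightOp 𝒜 a m = m * signHom 𝒜 k.2 a
  rw [rightOp_of_mem 𝒜 ha hm, signHom_of_mem _ _ ha, mul_smul_comm, mul_comm]

theorem rightOp_one (a : A) : rightOp 𝒜 a 1 = a := by
  rw [rightOp_of_mem_right (SetLike.GradedOne.one_mem (A := 𝒜)), Prod.snd_zero, signHom_zero,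
    one_mul]

/-- If `C_A(R) = A`, then `R` supercommutes with `A`. -/
theorem rightOp_map_of_superCentralizer_eq_top {f : ℛ →+*ᵍ 𝒜} (h : superCentralizer f = ⊤)
    (a : A) (r : R) : rightOp 𝒜 a (f r) = a * f r := by
  refine addMonoidHom_eq_of_homogeneous ℛ (f := (rightOp 𝒜 a).comp f.toRingHom.toAddMonoidHom)
    (g := (AddMonoidHom.mulLeft a).comp f.toRingHom.toAddMonoidHom) (fun k r hr => ?_) r
  change rightOp 𝒜 a (f r) = a * f r
  refine addMonoidHom_eq_of_homogeneous 𝒜 (f := (rightOp 𝒜).flip (f r))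
    (g := AddMonoidHom.mulRight (f r)) (fun i a ha => ?_) a
  change rightOp 𝒜 a (f r) = a * f r
  have hmem : a ∈ superCentralizer f := h ▸ AddSubgroup.mem_top a
  have := hmem i k r hr
  rw [decompose_of_mem_same 𝒜 ha] at this
  rw [this, rightOp_of_mem 𝒜 ha (gradedRingHom_mem f hr)]

end RightOp

theorem map_rightOp {A : Type*} [Ring A] {𝒜 : Λ × ZMod 2 → AddSubgroup A} [GradedRing 𝒜]
    {B : Type*} [Ring B] {ℬ : Λ × ZMod 2 → AddSubgroup B} [GradedRing ℬ] (j : ℬ →+*ᵍ 𝒜)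
    (b c : B) : j (rightOp ℬ b c) = rightOp 𝒜 (j b) (j c) := by
  refine addMonoidHom_eq_of_homogeneous ℬ
    (f := j.toRingHom.toAddMonoidHom.comp ((rightOp ℬ).flip c))
    (g := ((rightOp 𝒜).flip (j c)).comp j.toRingHom.toAddMonoidHom) (fun i b hb => ?_) b
  change j (rightOp ℬ b c) = rightOp 𝒜 (j b) (j c)
  rw [rightOp_of_mem_left hb, rightOp_of_mem_left (gradedRingHom_mem j hb), map_mul, map_signHom]

section Nakayama

variable {A : Type u₁} [Ring A] {𝒜 : Λ × ZMod 2 → AddSubgroup A} [GradedRing 𝒜]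
  {R : Type u₂} [Ring R] {ℛ : Λ × ZMod 2 → AddSubgroup R} [GradedRing ℛ]
  {f : ℛ →+*ᵍ 𝒜} {lam : Λ} {p : ZMod 2} {tr : A →+ R}

/-- This is the biadditive form of the Nakayama identity, with the sign hidden in `rightOp`. -/
theorem IsNakayama.trace_rightOp {ψ : 𝒜 →+*ᵍ 𝒜} (hψ : IsNakayama tr ψ) (a c : A) :
    tr (rightOp 𝒜 a c) = tr (a * ψ c) := by
  refine addMonoidHom_eq_of_homogeneous 𝒜 (f := tr.comp ((rightOp 𝒜).flip c))
    (g := tr.comp (AddMonoidHom.mulRight (ψ c))) (fun i a ha => ?_) a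
  refine addMonoidHom_eq_of_homogeneous 𝒜 (f := tr.comp (rightOp 𝒜 a))
    (g := (tr.comp (AddMonoidHom.mulLeft a)).comp ψ.toRingHom.toAddMonoidHom)
    (fun k c hc => ?_) c
  change tr (rightOp 𝒜 a c) = tr (a * ψ c)
  rw [rightOp_of_mem 𝒜 ha hc, map_units_smul, hψ.trace_mul i k a c ha hc, neg_one_uzpow_smul_self]

namespace IsTwistedFrobeniusWith

/-- (T1) concerns the right factor; the left expansion of `c` has coefficients built from `tr (c * y
s)`, which gives nondegeneracy in the left factor. -/
theorem eq_zero_of_trace_mul_right {α : 𝒜 →+*ᵍ 𝒜} {β : ℛ →+*ᵍ ℛ}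
    (h : IsTwistedFrobeniusWith f α β lam p tr) {c : A} (hc : ∀ a, tr (c * a) = 0) : c = 0 := by
  obtain ⟨n, d, x, y, -, -, hl, -⟩ := h.exists_dualGenerators
  rw [hl c]
  simp [hc]

variable (h : IsFrobeniusWith f lam p tr)
include h

/-- The parity of `tr (a * y)` is that of `a` plus that of `d`, the two copies of `p` cancelling.
This turns the sign automorphism into the explicit signs of `IsDualGenerators`. -/
theorem signHom_trace_mul {i d : Λ × ZMod 2} {a y : A} (ha : a ∈ 𝒜 i)
    (hy : y ∈ 𝒜 ((lam, p) - d)) :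
    signHom ℛ p (tr (a * y)) = ((-1 : ℤˣ) ^ (p * i.2)) • ((-1 : ℤˣ) ^ (p * d.2)) • tr (a * y) := by
  have hmem := h.map_mem _ _ (SetLike.mul_mem_graded ha hy)
  rw [signHom_of_mem _ _ hmem, neg_one_uzpow_smul_smul, ← mul_add]
  congr 3
  simp only [Prod.snd_sub, Prod.snd_add]
  rw [CharTwo.sub_eq_add, CharTwo.sub_eq_add, add_comm p, ← add_assoc, add_assoc _ p p,
    CharTwo.add_self_eq_zero, add_zero]

theorem exists_isDualGenerators : ∃ (n : ℕ) (dx : Fin n → Λ × ZMod 2) (x y : Fin n → A),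
    IsDualGenerators f lam p tr dx x y := by
  obtain ⟨n, d, x, y, hx, hy, hl, hr⟩ := h.exists_dualGenerators
  refine ⟨n, d, x, y, hx, hy, fun i a ha => ?_, hr⟩
  refine (hl a).trans ?_
  rw [Finset.smul_sum]
  refine Finset.sum_congr rfl fun s _ => ?_
  rw [GradedRingHom.id_apply, h.signHom_trace_mul ha (hy s), map_units_smul, map_units_smul,
    smul_mul_assoc, smul_mul_assoc]

variable (hf : ∀ a r, rightOp 𝒜 a (f r) = a * f r)
include hf

/-- The functional `a ↦ tr (rightOp 𝒜 a c)` is left linear over `R` because `f r` can be moved past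
`c`; this is where `hf` enters. -/
theorem exists_nakayama_of_mem {k : Λ × ZMod 2} {c : A} (hc : c ∈ 𝒜 k) :
    ∃ c' ∈ 𝒜 k, ∀ a, tr (rightOp 𝒜 a c) = tr (a * c') := by
  refine h.exists_eq_trace_mul k (tr.comp ((rightOp 𝒜).flip c)) (fun i a ha => ?_) fun r a => ?_
  · change tr (rightOp 𝒜 a c) ∈ _
    rw [rightOp_of_mem 𝒜 ha hc, map_units_smul]
    exact units_smul_mem _ _ (h.map_mem _ _ (SetLike.mul_mem_graded hc ha))
  · change tr (rightOp 𝒜 (f r * a) c) = signHom ℛ p r * tr (rightOp 𝒜 a c)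
    rw [← h.trace_left_mul, rightOp_of_mem_right hc, rightOp_of_mem_right hc, map_mul (signHom 𝒜 _),
      ← mul_assoc,
      ← map_signHom, ← hf, rightOp_of_mem_left hc, map_signHom, signHom_signHom_self, mul_assoc]
    rfl

theorem exists_nakayama (c : A) : ∃ c', ∀ a, tr (rightOp 𝒜 a c) = tr (a * c') := by
  induction c using Decomposition.inductionOn 𝒜 with
  | zero => exact ⟨0, fun a => by simp⟩
  | add c d hc hd =>
    obtain ⟨c', hc⟩ := hc
    obtain ⟨d', hd⟩ := hd
    exact ⟨c' + d', fun a => by rw [map_add, map_add, hc, hd, mul_add, map_add]⟩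
  | homogeneous c =>
    obtain ⟨c', -, hc⟩ := h.exists_nakayama_of_mem hf c.2
    exact ⟨c', hc⟩

/-- Surjectivity of the Nakayama map requires representing a right `R`-linear functional by
multiplication on the left of the argument of `tr`. Dual sets provide the representing element. -/
theorem exists_nakayama_preimage_of_mem {k : Λ × ZMod 2} {c' : A} (hc' : c' ∈ 𝒜 k) :
    ∃ c, ∀ a, tr (rightOp 𝒜 a c) = tr (a * c') := by
  obtain ⟨n, d, x, y, hx, hy, hl, hr⟩ := h.exists_dualGenerators
  let g : A →+ R := tr.comp ((AddMonoidHom.mulRight c').comp (signHom 𝒜 k.2).toAddMonoidHom)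
  have hg (a : A) : g a = tr (signHom 𝒜 k.2 a * c') := rfl
  have hgr (a : A) (r : R) : g (a * f r) = g a * r := by
    rw [hg, hg, ← h.map_right, map_mul (signHom 𝒜 _), mul_assoc, ← rightOp_of_mem_left hc', hf,
      ← mul_assoc]
    rfl
  -- The coefficients are the values of `g` on `y`; the sign compensates the one from left linearity
  -- of `tr`, so that `tr (c * a)` becomes `g` of the right expansion of `a`.
  let c : A := ∑ s, f (signHom ℛ p (g (y s))) * x s
  have hc (a : A) : tr (c * a) = g a := by
    conv_rhs => rw [hr a]
    simp only [c, Finset.sum_mul, map_sum, mul_assoc]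
    refine Finset.sum_congr rfl fun s _ => ?_
    refine (h.trace_left_mul (signHom ℛ p (g (y s))) _).trans ?_
    rw [signHom_signHom_self]
    exact (hgr _ _).symm
  have hck : c ∈ 𝒜 k := by
    refine sum_mem fun s _ => ?_
    have h1 : g (y s) ∈ ℛ ((lam, p) - d s + k - (lam, p)) :=
      h.map_mem _ _ (SetLike.mul_mem_graded (signHom_mem _ (hy s)) hc')
    have h2 := SetLike.mul_mem_graded (gradedRingHom_mem f (signHom_mem p h1)) (hx s)
    have e : (lam, p) - d s + k - (lam, p) + d s = k := by abel
    rwa [e] at h2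
  refine ⟨c, fun a => ?_⟩
  rw [rightOp_of_mem_right hck, hc, hg, signHom_signHom_self]

theorem existsUnique_isNakayama : ∃! ψ : 𝒜 →+*ᵍ 𝒜, IsNakayama tr ψ := by
  choose ψ hψ using h.exists_nakayama hf
  have huniq {c c' : A} (hc : ∀ a, tr (rightOp 𝒜 a c) = tr (a * c')) : ψ c = c' :=
    h.eq_of_trace_mul_eq fun a => by rw [← hψ, hc]
  have hadd (c d : A) : ψ (c + d) = ψ c + ψ d :=
    huniq fun a => by rw [map_add, map_add, hψ, hψ, mul_add, map_add]
  have hmem {k : Λ × ZMod 2} {c : A} (hc : c ∈ 𝒜 k) : ψ c ∈ 𝒜 k := by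
    obtain ⟨c', hc', h'⟩ := h.exists_nakayama_of_mem hf hc
    rwa [huniq h']
  let ψa : A →+ A := AddMonoidHom.mk' ψ hadd
  have hmul (c d : A) : ψ (c * d) = ψ c * ψ d := by
    refine addMonoidHom_eq_of_homogeneous 𝒜 (f := ψa.comp (AddMonoidHom.mulRight d))
      (g := (AddMonoidHom.mulRight (ψ d)).comp ψa) (fun k c hc => ?_) c
    refine addMonoidHom_eq_of_homogeneous 𝒜 (f := ψa.comp (AddMonoidHom.mulLeft c))
      (g := (AddMonoidHom.mulLeft (ψ c)).comp ψa) (fun l d hd => ?_) d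
    refine huniq fun a => ?_
    change tr (rightOp 𝒜 a (c * d)) = tr (a * (ψ c * ψ d))
    -- The product is moved around the trace one factor at a time: `h1` moves `c`, `h2` moves `d`.
    -- The arguments are sign-twisted so that the two results meet.
    have h1 := hψ c (signHom 𝒜 k.2 d * signHom 𝒜 l.2 a)
    have h2 := hψ d (a * ψ c)
    rw [rightOp_of_mem_right hc, map_mul (signHom 𝒜 _), signHom_signHom_self] at h1
    rw [rightOp_of_mem_right hd, map_mul (signHom 𝒜 _), signHom_of_mem _ l.2 (hmem hc),
      mul_comm l.2 k.2, mul_smul_comm, mul_smul_comm, map_units_smul] at h2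
    rw [rightOp_of_mem_right (SetLike.mul_mem_graded hc hd), Prod.snd_add, ← signHom_signHom,
      mul_assoc, ← mul_assoc a, ← h2]
    refine h1.trans ?_
    rw [signHom_of_mem _ _ hd, smul_mul_assoc, smul_mul_assoc, map_units_smul, mul_assoc]
  let Ψ : 𝒜 →+*ᵍ 𝒜 :=
    { ψa with
      map_one' := huniq fun a => by rw [rightOp_one, mul_one]
      map_mul' := hmul
      map_mem := hmem }
  have hΨ (c : A) : Ψ c = ψ c := rfl
  refine ⟨Ψ, ⟨⟨?_, ?_⟩, fun i k a c ha hc => ?_⟩, fun ψ' hψ' => ?_⟩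
  -- A component of an element killed by `Ψ` is again killed, and homogeneity makes the sign in
  -- `rightOp` removable, so left nondegeneracy applies.
  · refine (injective_iff_map_eq_zero Ψ).2 fun c hc => eq_of_component_eq 𝒜 fun k => ?_
    rw [map_zero]
    refine h.eq_zero_of_trace_mul_right fun a => ?_
    have h1 := hψ (component 𝒜 k c) (signHom 𝒜 k.2 a)
    rw [rightOp_of_mem_right (component_mem _ _ _), signHom_signHom_self, ← hΨ, component_apply,
      GradedRingHom.map_directSumDecompose, hc] at h1
    rw [component_apply, h1]
    simp
  · intro c'
    induction c' using Decomposition.inductionOn 𝒜 with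
    | zero => exact ⟨0, map_zero Ψ⟩
    | add c d hc hd =>
      obtain ⟨c', hc⟩ := hc
      obtain ⟨d', hd⟩ := hd
      exact ⟨c' + d', by rw [map_add, hc, hd]⟩
    | homogeneous c' =>
      obtain ⟨c, hc⟩ := h.exists_nakayama_preimage_of_mem hf c'.2
      exact ⟨c, huniq hc⟩
  · rw [hΨ, ← hψ, rightOp_of_mem 𝒜 ha hc, map_units_smul, neg_one_uzpow_smul_self]
  · exact GradedRingHom.ext fun c => (huniq fun a => hψ'.trace_rightOp a c).symm

/-- The Nakayama automorphism fixes the base ring. -/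
theorem nakayama_map {ψ : 𝒜 →+*ᵍ 𝒜} (hψ : IsNakayama tr ψ) (r : R) : ψ (f r) = f r :=
  h.eq_of_trace_mul_eq fun a => by rw [← hψ.trace_rightOp, hf]

end IsTwistedFrobeniusWith

end Nakayama

/-! ### Nested Frobenius extensions -/

section Nested

variable {R : Type u} [Ring R] {ℛ : Λ × ZMod 2 → AddSubgroup R} [GradedRing ℛ]
  {B : Type u₂} [Ring B] {ℬ : Λ × ZMod 2 → AddSubgroup B} [GradedRing ℬ]
  {A : Type u₁} [Ring A] {𝒜 : Λ × ZMod 2 → AddSubgroup A} [GradedRing 𝒜]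
  {i : ℛ →+*ᵍ ℬ} {j : ℬ →+*ᵍ 𝒜} {lamA lamB : Λ} {pA pB : ZMod 2} {trA : A →+ R} {trB : B →+ R}
  {ψA : 𝒜 →+*ᵍ 𝒜} {ψB : ℬ →+*ᵍ ℬ} {n : ℕ} {dx : Fin n → Λ × ZMod 2} {x y : Fin n → B}

theorem IsNakayama.trace_mul_of_mem (hψ : IsNakayama trA ψA) {l : Λ × ZMod 2} {c : A}
    (hc : c ∈ 𝒜 l) (a : A) : trA (c * a) = trA (signHom 𝒜 l.2 a * ψA c) := by
  rw [← hψ.trace_rightOp, rightOp_of_mem_right hc, signHom_signHom_self]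

variable (i j pB trA ψA x y) in
/-- The trace map of `A` over `B`, in terms of a dual set of generators of `B` over `R`. -/
def nestedTrace : A →+ B :=
  ∑ s, (AddMonoidHom.mulRight (x s)).comp ((i.toRingHom.comp (signHom ℛ pB)).toAddMonoidHom.comp
    (trA.comp (AddMonoidHom.mulRight (ψA (j (y s))))))

theorem nestedTrace_apply (a : A) : nestedTrace i j pB trA ψA x y a =
    ∑ s, i (signHom ℛ pB (trA (a * ψA (j (y s))))) * x s :=
  AddMonoidHom.finsetSum_apply _ _ _

section

variable (hA : IsFrobeniusWith (j.comp i) lamA pA trA)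
  (hd : IsDualGenerators i lamB pB trB dx x y)
include hA hd

/-- The definition has `ψA (j (y s))` on the right of `a`, so it makes sense for all `a`. Moving it
back to the left by the Nakayama identity yields the signed formula of the theorem. -/
theorem nestedTrace_of_mem (hψA : IsNakayama trA ψA) {k : Λ × ZMod 2} {a : A} (ha : a ∈ 𝒜 k) :
    nestedTrace i j pB trA ψA x y a = ((-1 : ℤˣ) ^ (pB * (pA + k.2))) •
      ∑ s, ((-1 : ℤˣ) ^ ((pB - (dx s).2) * (pB + k.2))) • (i (trA (j (y s) * a)) * x s) := by
  rw [nestedTrace_apply, Finset.smul_sum]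
  refine Finset.sum_congr rfl fun s _ => ?_
  have hy := gradedRingHom_mem j (hd.mem_right s)
  have hmem := hA.map_mem _ _ (SetLike.mul_mem_graded hy ha)
  rw [← hψA.trace_rightOp, rightOp_of_mem 𝒜 ha hy, map_units_smul, map_units_smul,
    signHom_of_mem _ _ hmem, map_units_smul, map_units_smul, smul_mul_assoc, smul_mul_assoc,
    neg_one_uzpow_smul_smul, neg_one_uzpow_smul_smul]
  congr 2
  simp only [Prod.snd_add, Prod.snd_sub]
  generalize k.2 = k, (dx s).2 = d
  clear * -
  -- What remains is an identity of exponents in `ZMod 2`, a finite check.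
  revert pA pB k d
  decide

theorem nestedTrace_mem {k : Λ × ZMod 2} {a : A} (ha : a ∈ 𝒜 k) :
    nestedTrace i j pB trA ψA x y a ∈ ℬ (k - (lamA - lamB, pA + pB)) := by
  rw [nestedTrace_apply]
  refine sum_mem fun s _ => ?_
  have hy := gradedRingHom_mem ψA (gradedRingHom_mem j (hd.mem_right s))
  have hmem := SetLike.mul_mem_graded (gradedRingHom_mem i
    (signHom_mem pB (hA.map_mem _ _ (SetLike.mul_mem_graded ha hy)))) (hd.mem_left s)
  have e : k + ((lamB, pB) - dx s) - (lamA, pA) + dx s = k - (lamA - lamB, pA + pB) := by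
    refine Prod.ext ?_ ?_
    · simp only [Prod.fst_add, Prod.fst_sub]
      abel
    · simp only [Prod.snd_add, Prod.snd_sub]
      -- In `ZMod 2` the parity `pA + pB` is the difference `pA - pB`, after which both coordinates
      -- are handled alike.
      rw [← CharTwo.sub_eq_add pA pB]
      abel
  rwa [e] at hmem

/-- A map homogeneous of parity `pA + pB` commutes with sign automorphisms up to a constant sign. -/
theorem signHom_nestedTrace (l : ZMod 2) (a : A) :
    signHom ℬ l (nestedTrace i j pB trA ψA x y a) =
      ((-1 : ℤˣ) ^ ((pA + pB) * l)) • nestedTrace i j pB trA ψA x y (signHom 𝒜 l a) := by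
  refine addMonoidHom_eq_of_homogeneous 𝒜
    (f := (signHom ℬ l).toAddMonoidHom.comp (nestedTrace i j pB trA ψA x y))
    (g := (DistribSMul.toAddMonoidHom B ((-1 : ℤˣ) ^ ((pA + pB) * l))).comp
      ((nestedTrace i j pB trA ψA x y).comp (signHom 𝒜 l).toAddMonoidHom)) (fun k a ha => ?_) a
  change signHom ℬ l (nestedTrace i j pB trA ψA x y a) =
      ((-1 : ℤˣ) ^ ((pA + pB) * l)) • nestedTrace i j pB trA ψA x y (signHom 𝒜 l a)
  rw [signHom_of_mem _ _ (nestedTrace_mem hA hd ha), signHom_of_mem _ _ ha, map_units_smul,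
    neg_one_uzpow_smul_smul]
  congr 2
  rw [Prod.snd_sub, CharTwo.sub_eq_add, mul_add, mul_comm (pA + pB), add_comm]

end

variable (hj : Function.Injective j)
  (hA : IsFrobeniusWith (j.comp i) lamA pA trA) (hB : IsFrobeniusWith i lamB pB trB)
  (hcA : ∀ a r, rightOp 𝒜 a (j.comp i r) = a * j.comp i r)
  (hψA : IsNakayama trA ψA) (hψB : IsNakayama trB ψB)
  (hd : IsDualGenerators i lamB pB trB dx x y)

include hA hB hcA hψA hd

/-- The trace map of `A` over `B` is determined by this equation. -/
theorem trace_nestedTrace_mul (a : A) (b : B) :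
    trB (nestedTrace i j pB trA ψA x y a * b) = trA (a * ψA (j b)) := by
  conv_rhs => rw [hd.right_expansion b]
  simp only [nestedTrace_apply, Finset.sum_mul, Finset.mul_sum, map_sum, mul_assoc]
  refine Finset.sum_congr rfl fun s _ => ?_
  refine (hB.trace_left_mul (signHom ℛ pB (trA (a * ψA (j (y s))))) _).trans ?_
  -- Since `ψA` fixes the image of `R`, the coefficient `trB (x s * b)` can leave `trA` on the
  -- right.
  have h1 : ψA (j (i (trB (x s * b)))) = j (i (trB (x s * b))) :=
    hA.nakayama_map hcA hψA (trB (x s * b))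
  rw [signHom_signHom_self, map_mul j, map_mul ψA, h1, ← mul_assoc]
  exact (hA.map_right _ _).symm

theorem trace_nestedTrace (a : A) : trB (nestedTrace i j pB trA ψA x y a) = trA a := by
  have := trace_nestedTrace_mul hA hB hcA hψA hd a 1
  rwa [mul_one, map_one, map_one, mul_one] at this

/-- Multiplying either side by any `b'` on the right and applying `trB` gives `trA (a * ψA (j (b *
b')))`. -/
theorem nestedTrace_mul_right (a : A) (b : B) : nestedTrace i j pB trA ψA x y (a * ψA (j b)) =
    nestedTrace i j pB trA ψA x y a * b := by
  rw [← sub_eq_zero]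
  refine hB.eq_zero_of_trace_mul_right fun b' => ?_
  have key := trace_nestedTrace_mul hA hB hcA hψA hd
  rw [sub_mul, map_sub, mul_assoc, key, key, mul_assoc, map_mul j, map_mul ψA, sub_self]

include hψB

/-- Under `trB`, the factor `b` moves cyclically to the right end as `ψB b`; the defining equation
passes to `trA`, where `ψA (j (ψB b))` moves back to the left end as `j (ψB b)`. -/
theorem nestedTrace_mul_left {l : Λ × ZMod 2} {b : B} (hb : b ∈ ℬ l) (a : A) :
    nestedTrace i j pB trA ψA x y (j (ψB b) * a) =
      ((-1 : ℤˣ) ^ ((pA + pB) * l.2)) • (b * nestedTrace i j pB trA ψA x y a) := by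
  rw [← sub_eq_zero]
  refine hB.eq_zero_of_trace_mul_right fun b' => ?_
  have key := trace_nestedTrace_mul hA hB hcA hψA hd
  have hb' := gradedRingHom_mem j (gradedRingHom_mem ψB hb)
  rw [sub_mul, map_sub, key, smul_mul_assoc, map_units_smul, mul_assoc b,
    hψB.trace_mul_of_mem hb, map_mul (signHom ℬ _), signHom_nestedTrace hA hd, smul_mul_assoc,
    smul_mul_assoc, map_units_smul, neg_one_uzpow_smul_self, mul_assoc, mul_assoc, key,
    hψA.trace_mul_of_mem hb', map_mul (signHom 𝒜 _), ← map_signHom ψA, ← map_signHom j,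
    mul_assoc, map_mul j, map_mul ψA, sub_self]

/-- This is (T2) in a single degree, reduced to (T2) of `A` over `R` by composing with `trB`. -/
theorem exists_eq_nestedTrace (hcB : ∀ b r, rightOp ℬ b (i r) = b * i r)
    (d : Λ × ZMod 2) (φ : A →+ B)
    (hφ : φ ∈ GSMod.homDeg (GSMod.ofHom (j.comp ψB)) (GSMod.shift (lamA - lamB) (pA + pB)
      (GSMod.ofHom (GradedRingHom.id ℬ))) d) :
    ∃ a : A, φ = (nestedTrace i j pB trA ψA x y).comp (rightOp 𝒜 a) := by
  have hleft (b : B) (c : A) : nestedTrace i j pB trA ψA x y (j (ψB b) * c) =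
      signHom ℬ (pA + pB) b * nestedTrace i j pB trA ψA x y c := by
    refine addMonoidHom_eq_of_homogeneous ℬ
      (f := (nestedTrace i j pB trA ψA x y).comp
        ((AddMonoidHom.mulRight c).comp (j.comp ψB).toRingHom.toAddMonoidHom))
      (g := (AddMonoidHom.mulRight (nestedTrace i j pB trA ψA x y c)).comp
        (signHom ℬ (pA + pB)).toAddMonoidHom) (fun l b hb => ?_) b
    change nestedTrace i j pB trA ψA x y (j (ψB b) * c) =
      signHom ℬ (pA + pB) b * nestedTrace i j pB trA ψA x y c
    rw [nestedTrace_mul_left hA hB hcA hψA hψB hd hb, signHom_of_mem _ _ hb, smul_mul_assoc]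
  have hφmem : ∀ k, ∀ c ∈ 𝒜 k, φ c ∈ ℬ (d + k - (lamA - lamB, pA + pB)) := hφ.1
  have hφlin : ∀ (l : Λ × ZMod 2) (b : B) (c : A), b ∈ ℬ l → φ (j (ψB b) * c) =
      ((-1 : ℤˣ) ^ (d.2 * l.2)) • (signHom ℬ (pA + pB) b * φ c) := hφ.2
  -- Composing with the sign automorphism cancels the degree-`d` sign, so that `θ` has exactly the
  -- left linearity of `nestedTrace`.
  let θ : A →+ B := φ.comp (signHom 𝒜 d.2).toAddMonoidHom
  have hθ (c : A) : θ c = φ (signHom 𝒜 d.2 c) := rfl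
  have hθlin (b : B) (c : A) : θ (j (ψB b) * c) = signHom ℬ (pA + pB) b * θ c := by
    refine addMonoidHom_eq_of_homogeneous ℬ
      (f := θ.comp ((AddMonoidHom.mulRight c).comp (j.comp ψB).toRingHom.toAddMonoidHom))
      (g := (AddMonoidHom.mulRight (θ c)).comp (signHom ℬ (pA + pB)).toAddMonoidHom)
      (fun l b hb => ?_) b
    change θ (j (ψB b) * c) = signHom ℬ (pA + pB) b * θ c
    rw [hθ, hθ, map_mul (signHom 𝒜 _),
      signHom_of_mem _ _ (gradedRingHom_mem j (gradedRingHom_mem ψB hb)), smul_mul_assoc,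
      map_units_smul, hφlin l b _ hb, neg_one_uzpow_smul_self]
  obtain ⟨a, had, ha⟩ := hA.exists_eq_trace_mul d (trB.comp θ) (fun k c hc => by
      have := hB.map_mem _ _ (hφmem k _ (signHom_mem d.2 hc))
      have e : d + k - (lamA - lamB, pA + pB) - (lamB, pB) = d + k - (lamA, pA) := by
        rw [sub_sub, Prod.mk_add_mk (lamA - lamB), sub_add_cancel, add_assoc, CharTwo.add_self_eq_zero, add_zero]
      rwa [e] at this) (fun r c => by
      change trB (θ (j (i r) * c)) = signHom ℛ pA r * trB (θ c)
      have h1 : ψB (i r) = i r := hB.nakayama_map hcB hψB r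
      -- As `ψB` fixes `R`, twisted linearity over `B` restricts to `R`; the parity `pB` of `trB`
      -- then cancels the one in `pA + pB`.
      rw [← h1, hθlin, ← map_signHom]
      refine (hB.trace_left_mul (signHom ℛ (pA + pB) r) _).trans ?_
      rw [signHom_signHom, add_comm pA, ← add_assoc, CharTwo.add_self_eq_zero, zero_add])
  replace ha (c : A) : trB (θ c) = trA (c * a) := ha c
  have hθa (c : A) : θ c = nestedTrace i j pB trA ψA x y (c * a) := by
    -- Both sides have the same left linearity, so a factor `b` can be brought inside; there `trB ∘
    -- θ` and `trB ∘ nestedTrace` are already known.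
    refine hB.eq_of_trace_mul_eq fun b => ?_
    have e := hθlin (signHom ℬ (pA + pB) b) c
    have e' := hleft (signHom ℬ (pA + pB) b) (c * a)
    rw [signHom_signHom_self] at e e'
    rw [← e, ← e', ha, trace_nestedTrace hA hB hcA hψA hd, mul_assoc]
  refine ⟨a, AddMonoidHom.ext fun c => ?_⟩
  rw [AddMonoidHom.comp_apply, rightOp_of_mem_left had, ← hθa, hθ, signHom_signHom_self]

include hj in
theorem isTwistedFrobeniusWith_nestedTrace
    (hproj : Module.Projective B (GSMod.ofHom j).carrier) :
    IsTwistedFrobeniusWith j ψA ψB (lamA - lamB) (pA + pB) (nestedTrace i j pB trA ψA x y) where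
  injective := hj
  bijective_left := hψA.bijective
  bijective_right := hψB.bijective
  finite := by
    -- Generators over `R` also generate over the larger ring `B`.
    obtain ⟨S, hS⟩ := hA.finite
    refine ⟨S, eq_top_iff.2 fun a _ => ?_⟩
    have ha : a ∈ Submodule.span R (M := (GSMod.ofHom (j.comp i)).carrier) S := by
      rw [hS]
      trivial
    induction ha using Submodule.span_induction with
    | mem a ha => exact Submodule.subset_span ha
    | zero => exact zero_mem _
    | add a b _ _ ha hb => exact add_mem (ha trivial) (hb trivial)
    | smul r a _ ha => exact Submodule.smul_mem _ (i r) (ha trivial)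
  projective := hproj
  map_mem _ _ ha := nestedTrace_mem hA hd ha
  map_left _ _ a hb := nestedTrace_mul_left hA hB hcA hψA hψB hd hb a
  map_right := nestedTrace_mul_right hA hB hcA hψA hd
  eq_zero a ha := hA.eq_zero a fun c => by
    rw [← trace_nestedTrace hA hB hcA hψA hd, ha, map_zero]
  exists_eq φ hφ := by
    have hcB (b : B) (r : R) : rightOp ℬ b (i r) = b * i r := hj <| by
      rw [map_rightOp, map_mul]
      exact hcA _ _
    -- `HOM` is the sum of its homogeneous parts, and representability is additive because `rightOp`
    -- is.
    refine AddSubgroup.iSup_induction _ (C := fun φ : A →+ B =>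
      ∃ a : A, φ = (nestedTrace i j pB trA ψA x y).comp (rightOp 𝒜 a)) hφ
      (fun d φ hφ => exists_eq_nestedTrace hA hB hcA hψA hψB hd hcB d φ hφ)
      ⟨0, by rw [map_zero, AddMonoidHom.comp_zero]⟩ ?_
    rintro _ _ ⟨a, rfl⟩ ⟨b, rfl⟩
    exact ⟨a + b, by rw [map_add, AddMonoidHom.comp_add]⟩

end Nested

/-! ### The adjunction between twisted restriction and induction -/

section Adjunction

variable {A : Type u₁} [Ring A] {𝒜 : Λ × ZMod 2 → AddSubgroup A} [GradedRing 𝒜]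
  {B : Type u₂} [Ring B] {ℬ : Λ × ZMod 2 → AddSubgroup B} [GradedRing ℬ]

/-- The element `a ⊗ m` of the shifted twisted restriction of `M`. -/
def resTmul (j : ℬ →+*ᵍ 𝒜) (α : 𝒜 →+*ᵍ 𝒜) (β : ℬ →+*ᵍ ℬ) (lam : Λ) (p : ZMod 2)
    (M : GSMod.{t, u₁, max u₁ w} 𝒜) (a : A) (m : M.carrier) :
    ((shiftedTwistedRestriction.{t, u₁, u₂, w} j α β lam p).obj M).carrier :=
  (GSBimod.ofHoms (j.comp β) α).tmul M a m

/-- The element `a ⊗ n` of the induction of `N`. -/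
def indTmul (j : ℬ →+*ᵍ 𝒜) (N : GSMod.{t, u₂, max u₁ w} ℬ) (a : A) (n : N.carrier) :
    ((inductionFunctor.{t, u₁, u₂, w} j).obj N).carrier :=
  (GSBimod.ofHoms (GradedRingHom.id 𝒜) j).tmul N a n

section Restriction

variable (j : ℬ →+*ᵍ 𝒜) (α : 𝒜 →+*ᵍ 𝒜) (β : ℬ →+*ᵍ ℬ) (lam : Λ) (p : ZMod 2)
  (M : GSMod.{t, u₁, max u₁ w} 𝒜)

theorem resTmul_add (a : A) (m n : M.carrier) : resTmul.{t, u₁, u₂, w} j α β lam p M a (m + n) =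
    resTmul.{t, u₁, u₂, w} j α β lam p M a m + resTmul.{t, u₁, u₂, w} j α β lam p M a n :=
  GSBimod.tmul_add _ _ _ _ _

theorem add_resTmul (a a' : A) (m : M.carrier) : resTmul.{t, u₁, u₂, w} j α β lam p M (a + a') m =
    resTmul.{t, u₁, u₂, w} j α β lam p M a m + resTmul.{t, u₁, u₂, w} j α β lam p M a' m :=
  GSBimod.add_tmul _ _ _ _ _

theorem sum_resTmul {n : ℕ} (a : Fin n → A) (m : M.carrier) :
    resTmul.{t, u₁, u₂, w} j α β lam p M (∑ s, a s) m =
      ∑ s, resTmul.{t, u₁, u₂, w} j α β lam p M (a s) m :=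
  map_sum (AddMonoidHom.mk' (fun a => resTmul.{t, u₁, u₂, w} j α β lam p M a m)
    fun a a' => add_resTmul j α β lam p M a a' m) a _

theorem resTmul_mul (a c : A) (m : M.carrier) : resTmul.{t, u₁, u₂, w} j α β lam p M (a * α c) m =
    resTmul.{t, u₁, u₂, w} j α β lam p M a (c • m) :=
  GSBimod.op_smul_tmul (GSBimod.ofHoms (j.comp β) α) M a c m

theorem smul_resTmul (b : B) (a : A) (m : M.carrier) :
    b • resTmul.{t, u₁, u₂, w} j α β lam p M a m =
      resTmul.{t, u₁, u₂, w} j α β lam p M (j (β (signHom ℬ p b)) * a) m :=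
  GSBimod.smul_tmul (GSBimod.ofHoms (j.comp β) α) M (signHom ℬ p b) a m

theorem resTmul_mem {i k : Λ × ZMod 2} {a : A} {m : M.carrier} (ha : a ∈ 𝒜 i)
    (hm : m ∈ M.grading k) : resTmul.{t, u₁, u₂, w} j α β lam p M a m ∈
      ((shiftedTwistedRestriction.{t, u₁, u₂, w} j α β lam p).obj M).grading
        (i + k + (lam, p)) := by
  have h := GSBimod.tmul_mem (P := GSBimod.ofHoms (j.comp β) α) ha hm
  rw [← add_sub_cancel_right (i + k) (lam, p)] at h
  exact h

variable {j α β lam p M} in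
theorem res_hom_ext {X : Type*} [AddCommGroup X]
    {f g : ((shiftedTwistedRestriction.{t, u₁, u₂, w} j α β lam p).obj M).carrier →+ X}
    (hfg : ∀ a m, f (resTmul.{t, u₁, u₂, w} j α β lam p M a m) =
      g (resTmul.{t, u₁, u₂, w} j α β lam p M a m)) (z) : f z = g z :=
  GSBimod.tensor_induction (GSBimod.ofHoms (j.comp β) α) (p := fun z => f z = g z)
    ((map_zero f).trans (map_zero g).symm)
    (fun y z hy hz => (map_add f y z).trans ((congrArg₂ _ hy hz).trans (map_add g y z).symm)) hfg z

end Restriction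

section Induction

variable (j : ℬ →+*ᵍ 𝒜) (N : GSMod.{t, u₂, max u₁ w} ℬ)

theorem indTmul_add (a : A) (m n : N.carrier) : indTmul.{t, u₁, u₂, w} j N a (m + n) =
    indTmul.{t, u₁, u₂, w} j N a m + indTmul.{t, u₁, u₂, w} j N a n :=
  GSBimod.tmul_add _ _ _ _ _

theorem add_indTmul (a a' : A) (n : N.carrier) : indTmul.{t, u₁, u₂, w} j N (a + a') n =
    indTmul.{t, u₁, u₂, w} j N a n + indTmul.{t, u₁, u₂, w} j N a' n :=
  GSBimod.add_tmul _ _ _ _ _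

theorem indTmul_sum {n : ℕ} (a : A) (m : Fin n → N.carrier) :
    indTmul.{t, u₁, u₂, w} j N a (∑ s, m s) = ∑ s, indTmul.{t, u₁, u₂, w} j N a (m s) :=
  map_sum (AddMonoidHom.mk' (fun m => indTmul.{t, u₁, u₂, w} j N a m)
    fun m m' => indTmul_add j N a m m') m _

theorem sum_indTmul {n : ℕ} (a : Fin n → A) (m : N.carrier) :
    indTmul.{t, u₁, u₂, w} j N (∑ s, a s) m = ∑ s, indTmul.{t, u₁, u₂, w} j N (a s) m :=
  map_sum (AddMonoidHom.mk' (fun a => indTmul.{t, u₁, u₂, w} j N a m)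
    fun a a' => add_indTmul j N a a' m) a _

theorem indTmul_mul (a : A) (b : B) (n : N.carrier) : indTmul.{t, u₁, u₂, w} j N (a * j b) n =
    indTmul.{t, u₁, u₂, w} j N a (b • n) :=
  GSBimod.op_smul_tmul (GSBimod.ofHoms (GradedRingHom.id 𝒜) j) N a b n

theorem smul_indTmul (c a : A) (n : N.carrier) : c • indTmul.{t, u₁, u₂, w} j N a n =
    indTmul.{t, u₁, u₂, w} j N (c * a) n :=
  GSBimod.smul_tmul (GSBimod.ofHoms (GradedRingHom.id 𝒜) j) N c a n

theorem indTmul_mem {i k : Λ × ZMod 2} {a : A} {n : N.carrier} (ha : a ∈ 𝒜 i)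
    (hn : n ∈ N.grading k) : indTmul.{t, u₁, u₂, w} j N a n ∈
      ((inductionFunctor.{t, u₁, u₂, w} j).obj N).grading (i + k) :=
  GSBimod.tmul_mem (P := GSBimod.ofHoms (GradedRingHom.id 𝒜) j) ha hn

variable {j N} in
theorem ind_hom_ext {X : Type*} [AddCommGroup X]
    {f g : ((inductionFunctor.{t, u₁, u₂, w} j).obj N).carrier →+ X}
    (hfg : ∀ a n, f (indTmul.{t, u₁, u₂, w} j N a n) = g (indTmul.{t, u₁, u₂, w} j N a n)) (z) :
    f z = g z :=
  GSBimod.tensor_induction (GSBimod.ofHoms (GradedRingHom.id 𝒜) j) (p := fun z => f z = g z)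
    ((map_zero f).trans (map_zero g).symm)
    (fun y z hy hz => (map_add f y z).trans ((congrArg₂ _ hy hz).trans (map_add g y z).symm)) hfg z

end Induction

namespace IsTwistedFrobeniusWith

variable {j : ℬ →+*ᵍ 𝒜} {α : 𝒜 →+*ᵍ 𝒜} {β : ℬ →+*ᵍ ℬ} {lam : Λ} {p : ZMod 2} {tr : A →+ B}
  (h : IsTwistedFrobeniusWith j α β lam p tr)

section Counit

variable (N : GSMod.{t, u₂, max u₁ w} ℬ)

/-- The map `a' ⊗ n ↦ tr (a α(a')) n`. -/
def traceAction (a : A) : ((inductionFunctor.{t, u₁, u₂, w} j).obj N).carrier →+ N.carrier :=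
  GSBimod.tensorLift (GSBimod.ofHoms (GradedRingHom.id 𝒜) j) N
    ((smulAddHom B N.carrier).comp
      (tr.comp ((AddMonoidHom.mulLeft a).comp α.toRingHom.toAddMonoidHom)))
    (fun (x : A) b n => by
      change tr (a * α (x * j b)) • n = tr (a * α x) • b • n
      rw [map_mul α, ← mul_assoc, h.map_right, mul_smul])

theorem traceAction_indTmul (a a' : A) (n : N.carrier) :
    h.traceAction N a (indTmul.{t, u₁, u₂, w} j N a' n) = tr (a * α a') • n := rfl

theorem traceAction_add (a a' : A) :
    h.traceAction.{t, u₁, u₂, w} N (a + a') = h.traceAction N a + h.traceAction N a' := by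
  refine AddMonoidHom.ext fun z => ind_hom_ext.{t, u₁, u₂, w} (fun c n => ?_) z
  rw [AddMonoidHom.add_apply, traceAction_indTmul, traceAction_indTmul, traceAction_indTmul,
    add_mul, map_add, add_smul]

/-- This is the balancing condition over `A` that lets `counitHom` descend to the tensor product. -/
theorem traceAction_mul (a c : A) (z : ((inductionFunctor.{t, u₁, u₂, w} j).obj N).carrier) :
    h.traceAction.{t, u₁, u₂, w} N (a * α c) z = h.traceAction N a (c • z) := by
  refine ind_hom_ext.{t, u₁, u₂, w} (f := h.traceAction N (a * α c))
    (g := (h.traceAction N a).comp (DistribSMul.toAddMonoidHom _ c)) (fun a' n => ?_) z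
  change _ = h.traceAction N a (c • indTmul.{t, u₁, u₂, w} j N a' n)
  rw [smul_indTmul, traceAction_indTmul, traceAction_indTmul, map_mul α, mul_assoc]

theorem traceAction_mul_left (b : B) (a : A)
    (z : ((inductionFunctor.{t, u₁, u₂, w} j).obj N).carrier) :
    h.traceAction.{t, u₁, u₂, w} N (j (β (signHom ℬ p b)) * a) z = b • h.traceAction N a z := by
  refine ind_hom_ext.{t, u₁, u₂, w} (f := h.traceAction N (j (β (signHom ℬ p b)) * a))
    (g := (DistribSMul.toAddMonoidHom _ b).comp (h.traceAction N a)) (fun a' n => ?_) z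
  change _ = b • h.traceAction N a (indTmul.{t, u₁, u₂, w} j N a' n)
  rw [traceAction_indTmul, traceAction_indTmul, mul_assoc, h.trace_left_mul, signHom_signHom_self,
    mul_smul]

/-- The map `a ⊗ (a' ⊗ n) ↦ tr (a α(a')) n`. -/
def counitHom : ((shiftedTwistedRestriction.{t, u₁, u₂, w} j α β (-lam) p).obj
    ((inductionFunctor.{t, u₁, u₂, w} j).obj N)).carrier →+ N.carrier :=
  GSBimod.tensorLift (GSBimod.ofHoms (j.comp β) α) _
    (AddMonoidHom.mk' (fun a : A => h.traceAction N a) (h.traceAction_add N))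
    (h.traceAction_mul N)

theorem counitHom_resTmul (a : A) (z) :
    h.counitHom N (resTmul.{t, u₁, u₂, w} j α β (-lam) p _ a z) = h.traceAction N a z := rfl

theorem counitHom_smul (b : B) (z) :
    h.counitHom.{t, u₁, u₂, w} N (b • z) = b • h.counitHom.{t, u₁, u₂, w} N z := by
  refine res_hom_ext.{t, u₁, u₂, w}
    (f := (h.counitHom.{t, u₁, u₂, w} N).comp (DistribSMul.toAddMonoidHom _ b))
    (g := (DistribSMul.toAddMonoidHom _ b).comp (h.counitHom.{t, u₁, u₂, w} N)) (fun a z => ?_) z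
  change h.counitHom.{t, u₁, u₂, w} N (b • resTmul.{t, u₁, u₂, w} j α β (-lam) p _ a z) =
    b • h.traceAction.{t, u₁, u₂, w} N a z
  rw [smul_resTmul, counitHom_resTmul, traceAction_mul_left]

/-- The shift by `(-lam, p)` and the degree of `tr` compensate each other, so the counit has degree
zero. -/
theorem counitHom_mem (k : Λ × ZMod 2) (z) (hz : z ∈
    ((shiftedTwistedRestriction.{t, u₁, u₂, w} j α β (-lam) p).obj
      ((inductionFunctor.{t, u₁, u₂, w} j).obj N)).grading k) :
    h.counitHom N z ∈ N.grading k := by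
  refine AddSubgroup.closure_induction (p := fun z _ => h.counitHom N z ∈ N.grading k) ?_ ?_ ?_ ?_
    hz
  · rintro _ ⟨d, l, (a : A), z, hdl, ha, hz, rfl⟩
    change h.traceAction N a z ∈ _
    refine AddSubgroup.closure_induction (p := fun z _ => h.traceAction N a z ∈ N.grading k)
      ?_ ?_ ?_ ?_ hz
    · rintro _ ⟨d', l', (a' : A), n, hdl', ha', hn, rfl⟩
      change tr (a * α a') • n ∈ _
      have hmem := N.smul_mem
        (h.map_mem _ _ (SetLike.mul_mem_graded ha (gradedRingHom_mem α ha'))) hn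
      have e : d + d' - (lam, p) + l' = k := by
        have hp : ((-lam, p) : Λ × ZMod 2) = -(lam, p) :=
          Prod.ext rfl (CharTwo.neg_eq p).symm
        rw [← hdl', hp, sub_neg_eq_add] at hdl
        rw [← add_sub_cancel_right k (lam, p), ← hdl]
        abel
      rwa [e] at hmem
    · rw [map_zero]
      exact zero_mem _
    · intro y z _ _ hy hz
      rw [map_add]
      exact add_mem hy hz
    · intro y _ hy
      rw [map_neg]
      exact neg_mem hy
  · rw [map_zero]
    exact zero_mem _
  · intro y z _ _ hy hz
    rw [map_add]
    exact add_mem hy hz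
  · intro y _ hy
    rw [map_neg]
    exact neg_mem hy

/-- The counit `a ⊗ (a' ⊗ n) ↦ tr (a α(a')) n` at `N`. -/
def counitApp : (shiftedTwistedRestriction.{t, u₁, u₂, w} j α β (-lam) p).obj
    ((inductionFunctor.{t, u₁, u₂, w} j).obj N) ⟶ N :=
  GSMod.Hom.mk { h.counitHom N with map_smul' := h.counitHom_smul N } (h.counitHom_mem N)

end Counit

/-- The counit `a ⊗ (a' ⊗ n) ↦ tr (a α(a')) n`. -/
def counit : inductionFunctor.{t, u₁, u₂, w} j ⋙
    shiftedTwistedRestriction.{t, u₁, u₂, w} j α β (-lam) p ⟶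
      𝟭 (GSMod.{t, u₂, max u₁ w} ℬ) where
  app N := h.counitApp.{t, u₁, u₂, w} N
  naturality N N' g := by
    refine GSMod.Hom.ext (LinearMap.ext fun z => ?_)
    refine res_hom_ext.{t, u₁, u₂, w} (f := (h.counitHom.{t, u₁, u₂, w} N').comp
      ((shiftedTwistedRestriction.{t, u₁, u₂, w} j α β (-lam) p).map
        ((inductionFunctor.{t, u₁, u₂, w} j).map g)).toLinearMap.toAddMonoidHom)
      (g := g.toLinearMap.toAddMonoidHom.comp (h.counitHom.{t, u₁, u₂, w} N)) (fun a z => ?_) z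
    refine ind_hom_ext.{t, u₁, u₂, w} (f := (h.traceAction.{t, u₁, u₂, w} N' a).comp
      ((inductionFunctor.{t, u₁, u₂, w} j).map g).toLinearMap.toAddMonoidHom)
      (g := g.toLinearMap.toAddMonoidHom.comp (h.traceAction.{t, u₁, u₂, w} N a))
      (fun c n => ?_) z
    exact (g.toLinearMap.map_smul (tr (a * α c)) n).symm

include h in
/-- A twisted restriction functor of a twisted Frobenius extension is left adjoint to
induction. -/
theorem nonempty_adjunction :
    Nonempty (shiftedTwistedRestriction.{t, u₁, u₂, w} j α β (-lam) p ⊣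
      inductionFunctor.{t, u₁, u₂, w} j) := by
  obtain ⟨n, d, v, y, hv, hy, hl, hr⟩ := h.exists_dualGenerators
  -- The right action on the restricted module is through `α`, so `y s` is written as `α (u s)`;
  -- applying the inverse of `α` to the second expansion gives one in terms of `u`.
  choose u hu using fun s => h.bijective_left.2 (y s)
  have hud (s : Fin n) : u s ∈ 𝒜 ((lam, p) - d s) :=
    mem_of_map_mem_of_bijective h.bijective_left (by rw [hu]; exact hy s)
  simp only [← hu] at hl hr
  replace hr (a : A) : ∑ s, u s * j (tr (v s * α a)) = a := by
    refine h.bijective_left.1 ?_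
    rw [map_sum]
    simp only [map_mul]
    exact (hr (α a)).symm
  let F := shiftedTwistedRestriction.{t, u₁, u₂, w} j α β (-lam) p
  let G := inductionFunctor.{t, u₁, u₂, w} j
  -- The unit inserts the Casimir element `∑ s, u s ⊗ v s` in front of `m`.
  let η (M : GSMod.{t, u₁, max u₁ w} 𝒜) (m : M.carrier) : (G.obj (F.obj M)).carrier :=
    ∑ s, indTmul.{t, u₁, u₂, w} j (F.obj M) (u s) (resTmul.{t, u₁, u₂, w} j α β (-lam) p M (v s) m)
  have η_add (M : GSMod.{t, u₁, max u₁ w} 𝒜) (m m' : M.carrier) :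
      η M (m + m') = η M m + η M m' := by
    simp only [η, resTmul_add, indTmul_add, Finset.sum_add_distrib]
  have η_smul (M : GSMod.{t, u₁, max u₁ w} 𝒜) (a : A) (m : M.carrier) :
      η M (a • m) = a • η M m := by
    -- The Casimir element commutes with `a`: `v s * α a` is expanded in the `v r`, the coefficients
    -- from `B` cross the tensor sign to `u s`, and summing over `s` reassembles `a * u r`.
    have h1 (s : Fin n) : indTmul.{t, u₁, u₂, w} j (F.obj M) (u s)
        (resTmul.{t, u₁, u₂, w} j α β (-lam) p M (v s) (a • m)) =
        ∑ r, indTmul.{t, u₁, u₂, w} j (F.obj M) (u s * j (tr (v s * α (a * u r))))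
          (resTmul.{t, u₁, u₂, w} j α β (-lam) p M (v r) m) := by
      rw [← resTmul_mul, hl (v s * α a), sum_resTmul, indTmul_sum]
      refine Finset.sum_congr rfl fun r _ => ?_
      rw [indTmul_mul, smul_resTmul, map_mul α, mul_assoc (v s)]
    change ∑ s, _ = a • ∑ s, _
    rw [Finset.sum_congr rfl fun s _ => h1 s, Finset.sum_comm, Finset.smul_sum]
    refine Finset.sum_congr rfl fun r _ => ?_
    rw [smul_indTmul, ← sum_indTmul, hr]
  have η_mem (M : GSMod.{t, u₁, max u₁ w} 𝒜) (k : Λ × ZMod 2) (m : M.carrier)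
      (hm : m ∈ M.grading k) : η M m ∈ (G.obj (F.obj M)).grading k := by
    refine sum_mem fun s _ => ?_
    have := indTmul_mem j (F.obj M) (hud s) (resTmul_mem j α β (-lam) p M (hv s) hm)
    have e : (lam, p) - d s + (d s + k + (-lam, p)) = k := by
      have hp : ((-lam, p) : Λ × ZMod 2) = -(lam, p) := Prod.ext rfl (CharTwo.neg_eq p).symm
      rw [hp]
      abel
    rwa [e] at this
  let unit : 𝟭 (GSMod.{t, u₁, max u₁ w} 𝒜) ⟶ F ⋙ G :=
    { app := fun M => (⟨{ toFun := η M, map_add' := η_add M, map_smul' := η_smul M }, η_mem M⟩ :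
        GSMod.Hom _ _)
      naturality := fun M M' g => by
        refine GSMod.Hom.ext (LinearMap.ext fun m => ?_)
        change η M' (g.toLinearMap m) = (G.map (F.map g)).toLinearMap (η M m)
        refine Eq.trans ?_ (map_sum (G.map (F.map g)).toLinearMap _ _).symm
        rfl }
  refine ⟨{
    unit := unit, counit := h.counit, left_triangle_components := fun M => ?_,
    right_triangle_components := fun N => ?_ }⟩
  · refine GSMod.Hom.ext (LinearMap.ext fun z => ?_)
    refine res_hom_ext.{t, u₁, u₂, w} (f := (h.counitHom.{t, u₁, u₂, w} (F.obj M)).comp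
      (F.map (unit.app M)).toLinearMap.toAddMonoidHom) (g := AddMonoidHom.id _) (fun a m => ?_) z
    change h.traceAction.{t, u₁, u₂, w} (F.obj M) a (η M m) =
      resTmul.{t, u₁, u₂, w} j α β (-lam) p M a m
    refine (map_sum (h.traceAction.{t, u₁, u₂, w} (F.obj M) a) _ _).trans ?_
    -- The first triangle identity is the left expansion of `a`.
    conv_rhs => rw [hl a, sum_resTmul]
    refine Finset.sum_congr rfl fun s _ => ?_
    rw [traceAction_indTmul, smul_resTmul]
  · refine GSMod.Hom.ext (LinearMap.ext fun z => ?_)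
    refine ind_hom_ext.{t, u₁, u₂, w}
      (f := (G.map (h.counit.{t, u₁, u₂, w}.app N)).toLinearMap.toAddMonoidHom.comp
        (unit.app (G.obj N)).toLinearMap.toAddMonoidHom) (g := AddMonoidHom.id _) (fun a m => ?_) z
    change (G.map (h.counit.{t, u₁, u₂, w}.app N)).toLinearMap
      (η (G.obj N) (indTmul.{t, u₁, u₂, w} j N a m)) = indTmul.{t, u₁, u₂, w} j N a m
    refine (map_sum (G.map (h.counit.{t, u₁, u₂, w}.app N)).toLinearMap _ _).trans ?_
    -- The second triangle identity is the right expansion of `a`, transported through `α`.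
    conv_rhs => rw [← hr a, sum_indTmul]
    refine Finset.sum_congr rfl fun s _ => ?_
    rw [indTmul_mul]
    rfl

end IsTwistedFrobeniusWith

end Adjunction

end NestedFrobenius

end

open NestedFrobenius in
theorem theorem3 {Λ : Type t} [AddCommGroup Λ] [DecidableEq Λ]
    {R : Type u} [Ring R] {ℛ : Λ × ZMod 2 → AddSubgroup R} [GradedRing ℛ]
    {B : Type u₂} [Ring B] {ℬ : Λ × ZMod 2 → AddSubgroup B} [GradedRing ℬ]
    {A : Type u₁} [Ring A] {𝒜 : Λ × ZMod 2 → AddSubgroup A} [GradedRing 𝒜]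
    (i : ℛ →+*ᵍ ℬ) (hi : Function.Injective i) (j : ℬ →+*ᵍ 𝒜) (hj : Function.Injective j)
    (hcent : superCentralizer (j.comp i) = ⊤)
    (lamA lamB : Λ) (pA pB : ZMod 2) (trA : A →+ R) (trB : B →+ R)
    (hA : IsFrobeniusWith (j.comp i) lamA pA trA) (hB : IsFrobeniusWith i lamB pB trB)
    (hproj : Module.Projective B (GSMod.ofHom j).carrier) :
    (∃! ψA : 𝒜 →+*ᵍ 𝒜, IsNakayama trA ψA) ∧
    (∃! ψB : ℬ →+*ᵍ ℬ, IsNakayama trB ψB) ∧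
    (∃ (n : ℕ) (dx : Fin n → Λ × ZMod 2) (x y : Fin n → B),
      IsDualGenerators i lamB pB trB dx x y) ∧
    ∀ (ψA : 𝒜 →+*ᵍ 𝒜) (ψB : ℬ →+*ᵍ ℬ), IsNakayama trA ψA → IsNakayama trB ψB →
      IsTwistedFrobenius j ψA ψB (lamA - lamB) (pA + pB) ∧
      (∀ (n : ℕ) (dx : Fin n → Λ × ZMod 2) (x y : Fin n → B),
        IsDualGenerators i lamB pB trB dx x y →
        ∃ tr : A →+ B,
          (∀ (k : Λ × ZMod 2) (a : A), a ∈ 𝒜 k →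
            tr a = ((-1 : ℤˣ) ^ (pB * (pA + k.2))) •
              ∑ s, ((-1 : ℤˣ) ^ ((pB - (dx s).2) * (pB + k.2))) •
                (i (trA (j (y s) * a)) * x s)) ∧
          IsTwistedFrobeniusWith j ψA ψB (lamA - lamB) (pA + pB) tr) ∧
      Nonempty (shiftedTwistedRestriction.{t, u₁, u₂, w} j ψA ψB (lamB - lamA) (pA + pB) ⊣
        inductionFunctor.{t, u₁, u₂, w} j) := by
  have hcA := rightOp_map_of_superCentralizer_eq_top hcent
  have hcB (b : B) (r : R) : rightOp ℬ b (i r) = b * i r := hj <| by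
    rw [map_rightOp, map_mul]
    exact hcA _ _
  have hdual := hB.exists_isDualGenerators
  refine ⟨hA.existsUnique_isNakayama hcA, hB.existsUnique_isNakayama hcB, hdual,
    fun ψA ψB hψA hψB => ?_⟩
  have htr (n : ℕ) (dx : Fin n → Λ × ZMod 2) (x y : Fin n → B)
      (hd : IsDualGenerators i lamB pB trB dx x y) :=
    isTwistedFrobeniusWith_nestedTrace hj hA hB hcA hψA hψB hd hproj
  obtain ⟨n, dx, x, y, hd⟩ := hdual
  refine ⟨⟨_, htr n dx x y hd⟩, fun n dx x y hd =>
    ⟨_, fun k a ha => nestedTrace_of_mem hA hd hψA ha, htr n dx x y hd⟩, ?_⟩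
  -- The functors do not involve the trace map, so any one pair of dual sets suffices here.
  have hadj := (htr n dx x y hd).nonempty_adjunction
  rwa [neg_sub] at hadj
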